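/- Let $G$ be a finite group, let $V$ be a finitely generated $\mathbb{Q}[G]$-module, and let $\mathcal{S}$ be the class of finitely generated (left) $\mathbb{Z}[G]$-modules $L$ such that $\mathbb{Q}\otimes_{\mathbb{Z}}L\cong V$ as $\mathbb{Q}[G]$-modules. For a $\mathbb{Z}[G]$-module $M$ and a submodule $L\subset M$, let $\operatorname{Aut}M$ and $\operatorname{Aut}L$ denote the groups of $\mathbb{Z}[G]$-module automorphisms, put $H=\{\sigma\in\operatorname{Aut}M:\sigma L=L\}$, and let $\rho\colon H\to\operatorname{Aut}L$ be the group homomorphism $\sigma\mapsto\sigma|_L$. If $M\in\mathcal{S}$ and $L\subset M$ is a submodule of finite index, then $L\in\mathcal{S}$, and the index $(\operatorname{Aut}M:H)$, the order $\#\ker\rho$ and the index $(\operatorname{Aut}L:\rho H)$ are finite. Moreover, there exists a unique function $\operatorname{ia}\colon\mathcal{S}\times\mathcal{S}\to\mathbb{Q}_{>0}$ such that (a) if $L,L',M,M'\in\mathcal{S}$ and $L\cong L'$, $M\cong M'$ as $\mathbb{Z}[G]$-modules, then $\operatorname{ia}(L,M)=\operatorname{ia}(L',M')$; (b) if $L,M,N\in\mathcal{S}$,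 then $\operatorname{ia}(L,M)\cdot\operatorname{ia}(M,N)=\operatorname{ia}(L,N)$; (c) if $M\in\mathcal{S}$ and $L\subset M$ is a submodule of finite index, then, with $H$ and $\rho$ as above, $$\operatorname{ia}(L,M)=\frac{(\operatorname{Aut}M:H)\cdot\#\ker\rho}{(\operatorname{Aut}L:\rho H)}.$$ -/

import Mathlib

open scoped TensorProduct

universe u v w

/-- The action of `a : ℤ[G]` on a `ℤ[G]`-module `L`, as an endomorphism of abelian groups. -/
noncomputable def intAction (G : Type*) [Group G] (L : Type*) [AddCommGroup L] [Module (MonoidAlgebra ℤ G) L] :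
    MonoidAlgebra ℤ G →+* Module.End ℤ L where
  toFun a := (DistribSMul.toAddMonoidHom L a).toIntLinearMap
  map_one' := by ext x; exact one_smul _ x
  map_mul' a b := by ext x; exact mul_smul a b x
  map_zero' := by ext x; exact zero_smul _ x
  map_add' a b := by ext x; exact add_smul a b x

/-- The ring homomorphism `ℚ[G] → End_ℚ (ℚ ⊗_ℤ L)` that extends `ℚ`-linearly the
action `g (q ⊗ x) = q ⊗ g x` of the elements of `G`. -/
noncomputable def ratAction (G : Type*) [Group G] (L : Type*) [AddCommGroup L]
    [Module (MonoidAlgebra ℤ G) L] :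
    MonoidAlgebra ℚ G →ₐ[ℚ] Module.End ℚ (ℚ ⊗[ℤ] L) :=
  MonoidAlgebra.lift ℚ (Module.End ℚ (ℚ ⊗[ℤ] L)) G
    { toFun := fun g => (intAction G L (MonoidAlgebra.of ℤ G g)).baseChange ℚ
      map_one' := by rw [map_one, map_one]; exact LinearMap.baseChange_id
      map_mul' := fun g h => by rw [map_mul, map_mul]; exact LinearMap.baseChange_comp _ _ }

/-- The `ℚ[G]`-module `ℚ ⊗_ℤ L` attached to a `ℤ[G]`-module `L`. -/
def RatExt (G : Type*) [Group G] (L : Type*) [AddCommGroup L] [Module (MonoidAlgebra ℤ G) L] :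
    Type _ :=
  ℚ ⊗[ℤ] L

noncomputable instance (G : Type*) [Group G] (L : Type*) [AddCommGroup L]
    [Module (MonoidAlgebra ℤ G) L] : AddCommGroup (RatExt G L) :=
  inferInstanceAs (AddCommGroup (ℚ ⊗[ℤ] L))

noncomputable instance (G : Type*) [Group G] (L : Type*) [AddCommGroup L]
    [Module (MonoidAlgebra ℤ G) L] : Module (MonoidAlgebra ℚ G) (RatExt G L) :=
  Module.compHom (ℚ ⊗[ℤ] L) (ratAction G L).toRingHom

/-- The class of finitely generated `ℤ[G]`-modules `L` with `ℚ ⊗_ℤ L ≅ V` as `ℚ[G]`-modules. -/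
def integralForms (G : Type u) [Group G] (V : Type v) [AddCommGroup V]
    [Module (MonoidAlgebra ℚ G) V] : Set (ModuleCat.{w} (MonoidAlgebra ℤ G)) :=
  {L | Module.Finite (MonoidAlgebra ℤ G) L ∧
    Nonempty (RatExt G L ≃ₗ[MonoidAlgebra ℚ G] V)}

/-- For a submodule `L` of `M`, the group `{σ ∈ Aut M : σ L = L}`. -/
def autStabilizer {R M : Type*} [Ring R] [AddCommGroup M] [Module R M] (L : Submodule R M) :
    Subgroup (M ≃ₗ[R] M) where
  carrier := {σ | L.map (σ : M →ₗ[R] M) = L}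
  one_mem' := Submodule.map_id L
  mul_mem' {σ τ} hσ hτ := by
    change L.map ((σ : M →ₗ[R] M).comp (τ : M →ₗ[R] M)) = L
    rw [Submodule.map_comp, hτ, hσ]
  inv_mem' {σ} hσ := by
    change L.map (σ.symm : M →ₗ[R] M) = L
    conv_lhs => rw [← (show L.map (σ : M →ₗ[R] M) = L from hσ)]
    rw [← Submodule.map_comp]
    simp

/-- Restriction `σ ↦ σ|L`, a group homomorphism `{σ ∈ Aut M : σ L = L} → Aut L`. -/
def autRestrict {R M : Type*} [Ring R] [AddCommGroup M] [Module R M] (L : Submodule R M) :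
    autStabilizer L →* (L ≃ₗ[R] L) where
  toFun σ := σ.1.ofSubmodules L L σ.2
  map_one' := by ext x; rfl
  map_mul' σ τ := by ext x; rfl

theorem ratAction_baseChange_subtype {G : Type*} [Group G] {M : Type*} [AddCommGroup M]
    [Module (MonoidAlgebra ℤ G) M] (L : Submodule (MonoidAlgebra ℤ G) M)
    (a : MonoidAlgebra ℚ G) (t : ℚ ⊗[ℤ] L) :
    (L.subtype.toAddMonoidHom.toIntLinearMap.baseChange ℚ) (ratAction G L a t) =
      ratAction G M a ((L.subtype.toAddMonoidHom.toIntLinearMap.baseChange ℚ) t) := by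
  induction a using MonoidAlgebra.induction_linear with
  | zero => simp
  | add x y hx hy => simp [hx, hy]
  | single g r =>
    induction t using TensorProduct.induction_on with
    | zero => simp
    | add x y hx hy => simp only [map_add, hx, hy]
    | tmul q x => simp [ratAction, intAction]

/-- If `L ⊆ M` has finite index then the inclusion induces `ℚ ⊗_ℤ L ≅ ℚ ⊗_ℤ M`. -/
theorem nonempty_ratExt_equiv {G : Type*} [Group G] {M : Type*} [AddCommGroup M]
    [Module (MonoidAlgebra ℤ G) M] (L : Submodule (MonoidAlgebra ℤ G) M)
    (hL : L.toAddSubgroup.FiniteIndex) :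
    Nonempty (RatExt G L ≃ₗ[MonoidAlgebra ℚ G] RatExt G M) := by
  let φ := L.subtype.toAddMonoidHom.toIntLinearMap.baseChange ℚ
  let ψ : RatExt G L →ₗ[MonoidAlgebra ℚ G] RatExt G M :=
    { toFun := φ
      map_add' := φ.map_add
      map_smul' := ratAction_baseChange_subtype L }
  refine ⟨LinearEquiv.ofBijective ψ ⟨?_, ?_⟩⟩
  · exact Module.Flat.lTensor_preserves_injective_linearMap (M := ℚ)
      L.subtype.toAddMonoidHom.toIntLinearMap Subtype.val_injective
  · change Function.Surjective φ
    intro t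
    induction t using TensorProduct.induction_on with
    | zero => exact ⟨0, map_zero _⟩
    | add x y hx hy =>
      obtain ⟨a, rfl⟩ := hx
      obtain ⟨b, rfl⟩ := hy
      exact ⟨a + b, map_add _ _ _⟩
    | tmul q x =>
      have hn : (L.toAddSubgroup.index : ℚ) ≠ 0 := Nat.cast_ne_zero.mpr hL.index_ne_zero
      have hx : (L.toAddSubgroup.index : ℤ) • x ∈ L := by
        rw [natCast_zsmul]
        exact L.toAddSubgroup.nsmul_index_mem x
      refine ⟨(q / L.toAddSubgroup.index) ⊗ₜ[ℤ] (⟨_, hx⟩ : L), ?_⟩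
      change (q / L.toAddSubgroup.index) ⊗ₜ[ℤ] ((L.toAddSubgroup.index : ℤ) • x) = q ⊗ₜ[ℤ] x
      rw [← TensorProduct.smul_tmul]
      congr 1
      rw [zsmul_eq_mul, Int.cast_natCast, mul_div_cancel₀ _ hn]

/-- A finite-index submodule of a module in `integralForms G V` is again in it. -/
theorem integralForms_submodule {G : Type u} [Group G] [Finite G] {V : Type v}
    [AddCommGroup V] [Module (MonoidAlgebra ℚ G) V]
    (M : integralForms.{u, v, w} G V) (L : Submodule (MonoidAlgebra ℤ G) M.1)
    (hL : L.toAddSubgroup.FiniteIndex) :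
    ModuleCat.of (MonoidAlgebra ℤ G) L ∈ integralForms.{u, v, w} G V := by
  obtain ⟨hfin, ⟨e⟩⟩ := M.2
  obtain ⟨f⟩ := nonempty_ratExt_equiv L hL
  have h1 : Module.Finite ℤ (MonoidAlgebra ℤ G) :=
    Module.Finite.equiv (MonoidAlgebra.coeffLinearEquiv ℤ).symm
  have h2 : IsNoetherianRing (MonoidAlgebra ℤ G) := isNoetherian_of_tower ℤ inferInstance
  exact ⟨inferInstanceAs (Module.Finite (MonoidAlgebra ℤ G) L), ⟨f.trans e⟩⟩

/-!
# Indices of automorphism groups of integral forms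

The number `ia(L, M)` plays the role of `#Aut M / #Aut L`, although both groups may be infinite.
Through an isomorphism `e : ℚ ⊗ M ≅ V` the group `Aut M` acts on `V`, with finite kernel
(`finite_ker_autRat`), and the images in `Aut V` of the automorphism groups of all integral forms
are commensurable (`commensurable_range_autRat`). Commensurable subgroups have a generalised index
`[A : B] = [A : A ∩ B] / [B : A ∩ B]`, which is multiplicative. Fixing one such image `Γ`, the order
of `Aut M` relative to `Γ` is `relOrder Γ e = #ker · [image : Γ]`, and `ia(L, M)` is the quotient of
the relative orders of `M` and `L`. Multiplicativity is then clear, and the formula for `L ⊆ M` is a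
computation with indices (`Subgroup.card_ker_mul_genIndex_range`), because the stabiliser `H` of `L`
in `Aut M` has the same image in `Aut V` as its restriction to `L`.

The essential point is that the relative order does not depend on `e`. Replacing `e` by `g ∘ e`
multiplies it by `[g A g⁻¹ : A]`, where `A` is the image of `Aut M`; this is a homomorphism from
`Aut V` to the positive rationals that is trivial on the centre. Since the target is commutative and
torsion-free, such a homomorphism vanishes identically (`CentralHomTrivial.linearEquiv`): by Maschke
and Wedderburn–Artin, `Aut V` is a product of general linear groups over division algebras `D` of
finite dimension over `ℚ`. These are generated by dilatransvections. Transvections are conjugate to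
their squares, hence die in a commutative quotient; dilations with ratio `d` are all conjugate, and
this gives a homomorphism on `Dˣ`, trivial on the centre because a power of a dilation with central
ratio is a homothety modulo commutators. Finally Wedderburn's factorization of the minimal
polynomial vanishing on the conjugacy class of `d` shows that a product of conjugates
of `d` is central up to sign, so that some power of `d` is central modulo commutators.

The finiteness statements rest on congruence subgroups: automorphisms trivial modulo `n` form a
subgroup of finite index, which stabilises `L` when `n = (M : L)`, and, for a suitable multiple of
`n`, automorphisms of `L` in that subgroup extend to `M`
(`ker_autQuotient_le_range_autRestrict`). Uniqueness holds because any two integral forms have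
isomorphic submodules of finite index (`exists_common_submodule`).
-/

/-! ### Generalised indices of commensurable subgroups -/

namespace Subgroup

variable {G : Type*} [Group G]

/-- The generalised index `[A : B] = [A : A ∩ B] / [B : A ∩ B]` of two subgroups. It is meaningful
for commensurable `A` and `B`, and agrees with the index of `B` in `A` when `B ≤ A`. -/
noncomputable def genIndex (A B : Subgroup G) : ℚ :=
  (B.relIndex A : ℚ) / (A.relIndex B : ℚ)

theorem genIndex_pos {A B : Subgroup G} (h : Commensurable A B) : 0 < genIndex A B :=
  div_pos (Nat.cast_pos.2 (Nat.pos_of_ne_zero h.2)) (Nat.cast_pos.2 (Nat.pos_of_ne_zero h.1))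

theorem genIndex_self (A : Subgroup G) : genIndex A A = 1 := by simp [genIndex]

theorem genIndex_eq_of_le {A B D : Subgroup G} (hA : D ≤ A) (hB : D ≤ B)
    (hDA : D.relIndex A ≠ 0) :
    genIndex A B = (D.relIndex A : ℚ) / (D.relIndex B : ℚ) := by
  have key : ∀ {A B : Subgroup G}, D ≤ A → D ≤ B →
      D.relIndex (A ⊓ B) * B.relIndex A = D.relIndex A := fun {A B} hA hB => by
    rw [← inf_relIndex_left A B]
    exact relIndex_mul_relIndex D (A ⊓ B) A (le_inf hA hB) inf_le_left
  have h1 := key hA hB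
  have h2 := key hB hA
  rw [inf_comm] at h2
  have h3 : (D.relIndex (A ⊓ B) : ℚ) ≠ 0 :=
    Nat.cast_ne_zero.2 fun h => hDA (by rw [← h1, h, zero_mul])
  rw [genIndex, ← h1, ← h2]
  push_cast
  rw [mul_div_mul_left _ _ h3]

theorem genIndex_mul_genIndex {A B C : Subgroup G} (hAB : Commensurable A B)
    (hBC : Commensurable B C) : genIndex A B * genIndex B C = genIndex A C := by
  have hAC := hAB.trans hBC
  have hA : (A ⊓ B ⊓ C).relIndex A ≠ 0 :=
    relIndex_inf_ne_zero (relIndex_inf_ne_zero (by simp) hAB.2) hAC.2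
  have hB : (A ⊓ B ⊓ C).relIndex B ≠ 0 :=
    relIndex_inf_ne_zero (relIndex_inf_ne_zero hAB.1 (by simp)) hBC.2
  have lA : A ⊓ B ⊓ C ≤ A := inf_le_left.trans inf_le_left
  have lB : A ⊓ B ⊓ C ≤ B := inf_le_left.trans inf_le_right
  have lC : A ⊓ B ⊓ C ≤ C := inf_le_right
  rw [genIndex_eq_of_le lA lB hA, genIndex_eq_of_le lB lC hB, genIndex_eq_of_le lA lC hA]
  have hB' : ((A ⊓ B ⊓ C).relIndex B : ℚ) ≠ 0 := Nat.cast_ne_zero.2 hB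
  field_simp

theorem relIndex_map_equiv {G' : Type*} [Group G'] (f : G ≃* G') (A B : Subgroup G) :
    (A.map f.toMonoidHom).relIndex (B.map f.toMonoidHom) = A.relIndex B :=
  relIndex_map_map_of_injective A B f.injective

theorem genIndex_map_equiv {G' : Type*} [Group G'] (f : G ≃* G') (A B : Subgroup G) :
    genIndex (A.map f.toMonoidHom) (B.map f.toMonoidHom) = genIndex A B := by
  rw [genIndex, genIndex, relIndex_map_equiv, relIndex_map_equiv]

theorem Commensurable.map_equiv {G' : Type*} [Group G'] (f : G ≃* G') {A B : Subgroup G}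
    (h : Commensurable A B) : Commensurable (A.map f.toMonoidHom) (B.map f.toMonoidHom) := by
  rw [Commensurable, relIndex_map_equiv, relIndex_map_equiv]
  exact h

theorem relIndex_sup_of_normal (H N : Subgroup G) [N.Normal] :
    H.relIndex (H ⊔ N) = H.relIndex N := by
  let f := quotientSubgroupOfEmbeddingOfLE H (le_sup_right : N ≤ H ⊔ N)
  have hf : Function.Surjective f := fun q => by
    induction q using QuotientGroup.induction_on with
    | H x =>
      obtain ⟨x, hx⟩ := x
      have hx' : x ∈ N ⊔ H := by rwa [sup_comm]
      obtain ⟨n, hn, h, hh, e⟩ := mem_sup_of_normal_left.1 hx'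
      refine ⟨((⟨n, hn⟩ : N) : N ⧸ H.subgroupOf N), ?_⟩
      refine (quotientSubgroupOfEmbeddingOfLE_apply_mk H le_sup_right _).trans ?_
      refine QuotientGroup.eq.2 (mem_subgroupOf.2 ?_)
      simpa [← e] using hh
  exact (Nat.card_congr (Equiv.ofBijective f ⟨f.injective, hf⟩)).symm

/-- For a homomorphism `φ` with finite kernel, restriction to a subgroup `H` of finite index divides
the formal order `#ker φ · #im φ` by the index of `H`, also when the image is infinite. -/
theorem card_ker_mul_relIndex_map_range {X : Type*} [Group X] (φ : X →* G) (H : Subgroup X)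
    [Finite φ.ker] :
    Nat.card φ.ker * (H.map φ).relIndex φ.range =
      H.index * Nat.card (φ.ker ⊓ H : Subgroup X) := by
  have h1 : (H.map φ).relIndex φ.range = (H ⊔ φ.ker).index := by
    rw [MonoidHom.range_eq_map, relIndex_map_map, top_sup_eq, relIndex_top_right]
  have h2 : (H ⊔ φ.ker).index * H.relIndex φ.ker = H.index := by
    rw [← relIndex_sup_of_normal, mul_comm]
    exact relIndex_mul_index le_sup_left
  have h3 : Nat.card (φ.ker ⊓ H : Subgroup X) * H.relIndex φ.ker = Nat.card φ.ker := by
    rw [← inf_relIndex_left, ← relIndex_bot_left, ← relIndex_bot_left φ.ker]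
    exact relIndex_mul_relIndex _ _ _ bot_le inf_le_left
  rw [h1, ← h2, ← h3]
  ring

/-- The kernel of a composite `ψ ∘ ρ` has order `#ker ρ · #(ker ψ ∩ im ρ)`. -/
theorem card_ker_comp {X Y : Type*} [Group X] [Group Y] (ρ : X →* Y) (ψ : Y →* G) :
    Nat.card (ψ.comp ρ).ker = Nat.card ρ.ker * Nat.card (ψ.ker ⊓ ρ.range : Subgroup Y) := by
  have h1 : ρ.ker ≤ (ψ.comp ρ).ker := fun x hx => by
    rw [MonoidHom.mem_ker] at hx ⊢
    simp [hx]
  have h2 : (ψ.comp ρ).ker.map ρ = ψ.ker ⊓ ρ.range := by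
    ext y
    constructor
    · rintro ⟨x, hx, rfl⟩
      exact ⟨hx, x, rfl⟩
    · rintro ⟨hy, x, rfl⟩
      exact ⟨x, hy, rfl⟩
  rw [← h2, ← relIndex_ker, ← relIndex_bot_left, ← relIndex_bot_left ρ.ker]
  exact (relIndex_mul_relIndex _ _ _ bot_le h1).symm

/-- If `H` has finite index in `X`, the image of `ρ : H → Y` has finite index in `Y`, and `φ` and
`ψ` are homomorphisms to a common group that are compatible with `ρ`, then the images of `φ` and `ψ`
are commensurable: both contain `φ(H)` with finite index. -/
theorem commensurable_range {X Y : Type*} [Group X] [Group Y] (H : Subgroup X) (ρ : H →* Y)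
    (φ : X →* G) (ψ : Y →* G) (h : ∀ x : H, ψ (ρ x) = φ x) [H.FiniteIndex]
    [ρ.range.FiniteIndex] : Commensurable φ.range ψ.range := by
  have hC : H.map φ = ρ.range.map ψ := by
    ext z
    constructor
    · rintro ⟨x, hx, rfl⟩
      exact ⟨ρ ⟨x, hx⟩, ⟨_, rfl⟩, h _⟩
    · rintro ⟨_, ⟨x, rfl⟩, rfl⟩
      exact ⟨x, x.2, (h x).symm⟩
  have h1 : (H.map φ).relIndex φ.range ≠ 0 := by
    rw [MonoidHom.range_eq_map, relIndex_map_map, top_sup_eq, relIndex_top_right]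
    exact (finiteIndex_of_le (H := H) le_sup_left).index_ne_zero
  have h2 : (H.map φ).relIndex ψ.range ≠ 0 := by
    rw [hC, MonoidHom.range_eq_map ψ, relIndex_map_map, top_sup_eq, relIndex_top_right]
    exact (finiteIndex_of_le (H := ρ.range) le_sup_left).index_ne_zero
  have h3 : H.map φ ≤ φ.range := MonoidHom.range_eq_map φ ▸ map_mono le_top
  have h4 : H.map φ ≤ ψ.range := hC ▸ MonoidHom.range_eq_map ψ ▸ map_mono le_top
  exact ⟨fun h0 => h2 (relIndex_eq_zero_of_le_left h3 h0),
    fun h0 => h1 (relIndex_eq_zero_of_le_left h4 h0)⟩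

/-- In the situation of `commensurable_range`, the formal quotient of the orders of `X` and `Y` can
be computed from `H` and `ρ`, or from the images of `φ` and `ψ`. -/
theorem card_ker_mul_genIndex_range {X Y : Type*} [Group X] [Group Y] (H : Subgroup X)
    (ρ : H →* Y) (φ : X →* G) (ψ : Y →* G) (h : ∀ x : H, ψ (ρ x) = φ x) [H.FiniteIndex]
    [ρ.range.FiniteIndex] [Finite φ.ker] [Finite ψ.ker] :
    (Nat.card φ.ker : ℚ) * genIndex φ.range ψ.range =
      (H.index : ℚ) * Nat.card ρ.ker / ρ.range.index * Nat.card ψ.ker := by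
  have hC : H.map φ = ρ.range.map ψ := by
    ext z
    constructor
    · rintro ⟨x, hx, rfl⟩
      exact ⟨ρ ⟨x, hx⟩, ⟨_, rfl⟩, h _⟩
    · rintro ⟨_, ⟨x, rfl⟩, rfl⟩
      exact ⟨x, x.2, (h x).symm⟩
  have h3 : H.map φ ≤ φ.range := MonoidHom.range_eq_map φ ▸ map_mono le_top
  have h4 : H.map φ ≤ ψ.range := hC ▸ MonoidHom.range_eq_map ψ ▸ map_mono le_top
  have e1 := card_ker_mul_relIndex_map_range φ H
  have e2 := card_ker_mul_relIndex_map_range ψ ρ.range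
  have e3 : Nat.card (φ.ker ⊓ H : Subgroup X) =
      Nat.card ρ.ker * Nat.card (ψ.ker ⊓ ρ.range : Subgroup Y) := by
    rw [← card_ker_comp ρ ψ]
    have : (ψ.comp ρ).ker.map H.subtype = φ.ker ⊓ H := by
      ext x
      constructor
      · rintro ⟨x, hx, rfl⟩
        exact ⟨(h x).symm.trans hx, x.2⟩
      · rintro ⟨hx, hxH⟩
        exact ⟨⟨x, hxH⟩, (h ⟨x, hxH⟩).trans hx, rfl⟩
    rw [← this]
    exact Nat.card_congr ((ψ.comp ρ).ker.equivMapOfInjective _ H.subtype_injective).symm.toEquiv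
  rw [← hC] at e2
  have p1 : Nat.card φ.ker ≠ 0 := Nat.card_pos.ne'
  have p2 : Nat.card ψ.ker ≠ 0 := Nat.card_pos.ne'
  have p3 : Nat.card (ψ.ker ⊓ ρ.range : Subgroup Y) ≠ 0 := by
    have : Finite (ψ.ker ⊓ ρ.range : Subgroup Y) :=
      Finite.of_injective _ (inclusion_injective (inf_le_left : ψ.ker ⊓ ρ.range ≤ ψ.ker))
    exact Nat.card_pos.ne'
  have p4 : Nat.card (φ.ker ⊓ H : Subgroup X) ≠ 0 := by
    have : Finite (φ.ker ⊓ H : Subgroup X) :=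
      Finite.of_injective _ (inclusion_injective (inf_le_left : φ.ker ⊓ H ≤ φ.ker))
    exact Nat.card_pos.ne'
  have p5 : H.index ≠ 0 := FiniteIndex.index_ne_zero
  have p6 : ρ.range.index ≠ 0 := FiniteIndex.index_ne_zero
  have q1 : (H.map φ).relIndex φ.range ≠ 0 := fun h0 => by
    rw [h0, mul_zero] at e1
    exact mul_ne_zero p5 p4 e1.symm
  have q2 : (H.map φ).relIndex ψ.range ≠ 0 := fun h0 => by
    rw [h0, mul_zero] at e2
    exact mul_ne_zero p6 p3 e2.symm
  rw [genIndex_eq_of_le h3 h4 q1]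
  rw [e3] at e1
  have q2' : ((H.map φ).relIndex ψ.range : ℚ) ≠ 0 := Nat.cast_ne_zero.2 q2
  have p6' : (ρ.range.index : ℚ) ≠ 0 := Nat.cast_ne_zero.2 p6
  have e1' : (Nat.card φ.ker : ℚ) * (H.map φ).relIndex φ.range = H.index *
    (Nat.card ρ.ker * Nat.card (ψ.ker ⊓ ρ.range : Subgroup Y)) := by exact_mod_cast e1
  have e2' : (Nat.card ψ.ker : ℚ) * (H.map φ).relIndex ψ.range = ρ.range.index *
    Nat.card (ψ.ker ⊓ ρ.range : Subgroup Y) := by exact_mod_cast e2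
  rw [← mul_div_assoc, e1', div_mul_eq_mul_div, div_eq_div_iff q2' p6']
  linear_combination (-(H.index : ℚ) * Nat.card ρ.ker) * e2'

/-- The modular function `g ↦ [g Γ g⁻¹ : Γ]` of a subgroup `Γ` that is commensurable with all its
conjugates; it is a homomorphism to the positive rationals. -/
noncomputable def modularHom (Γ : Subgroup G)
    (hΓ : ∀ g : G, Commensurable (Γ.map (MulAut.conj g).toMonoidHom) Γ) :
    G →* {q : ℚ // 0 < q} where
  toFun g := ⟨genIndex (Γ.map (MulAut.conj g).toMonoidHom) Γ, genIndex_pos (hΓ g)⟩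
  map_one' := by
    have : (MulAut.conj (1 : G)).toMonoidHom = MonoidHom.id G := by ext; simp
    exact Subtype.ext (by simp only [this, map_id]; exact genIndex_self Γ)
  map_mul' g h := by
    have e : Γ.map (MulAut.conj (g * h)).toMonoidHom =
        (Γ.map (MulAut.conj h).toMonoidHom).map (MulAut.conj g).toMonoidHom := by
      rw [map_map]
      congr 1
      ext
      simp
    refine Subtype.ext ?_
    change genIndex _ _ = genIndex _ _ * genIndex _ _
    rw [e, ← genIndex_mul_genIndex ((hΓ h).map_equiv (MulAut.conj g)) (hΓ g),
      genIndex_map_equiv, mul_comm]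

end Subgroup

/-! ### Wedderburn's factorization over a division ring -/

namespace Polynomial

variable {D : Type*} [DivisionRing D]

/-- Over a division ring, with evaluation `∑ aᵢ cⁱ` at `c`, the value of a product `g * h` at a
point `c` with `h(c) ≠ 0` is governed by the value of `g` at the conjugate of `c` by `h(c)`. -/
theorem eval_mul_of_eval_ne_zero (g h : D[X]) {c : D} (hc : h.eval c ≠ 0) :
    (g * h).eval c = g.eval (h.eval c * c * (h.eval c)⁻¹) * h.eval c := by
  induction g using Polynomial.induction_on' with
  | add p q hp hq => rw [add_mul, eval_add, hp, hq, eval_add, add_mul]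
  | monomial n a =>
    have h1 : monomial n a * h = C a * (h * X ^ n) := by
      rw [← C_mul_X_pow_eq_monomial, mul_assoc, X_pow_mul]
    have h2 : ∀ (k : ℕ), (h.eval c * c * (h.eval c)⁻¹) ^ k = h.eval c * c ^ k * (h.eval c)⁻¹ := by
      intro k
      induction k with
      | zero => simp [hc]
      | succ k ih =>
        rw [pow_succ, ih, pow_succ]
        simp only [mul_assoc, inv_mul_cancel_left₀ hc]
    rw [h1, eval_C_mul, eval_mul_X_pow, eval_monomial, h2, mul_assoc a, mul_assoc,
      inv_mul_cancel₀ hc, mul_one]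

/-- Division on the right by `X - c` over a noncommutative ring: the remainder is the value at
`c`. -/
theorem exists_eq_mul_X_sub_C {R : Type*} [Ring R] (g : R[X]) (c : R) :
    ∃ q : R[X], g = q * (X - C c) + C (g.eval c) := by
  induction g using Polynomial.induction_on' with
  | add p q hp hq =>
    obtain ⟨p', hp'⟩ := hp
    obtain ⟨q', hq'⟩ := hq
    refine ⟨p' + q', ?_⟩
    rw [eval_add, C_add, add_mul]
    nth_rewrite 1 [hp', hq']
    abel
  | monomial n a =>
    refine ⟨C a * ∑ i ∈ Finset.range n, X ^ i * C c ^ (n - 1 - i), ?_⟩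
    rw [mul_assoc, (commute_X (C c)).geom_sum₂_mul n, eval_monomial, mul_sub, ← C_pow, ← C_mul,
      C_mul_X_pow_eq_monomial]
    simp

/-- Conjugation by a unit, as a ring endomorphism. -/
def unitConj (u : Dˣ) : D →+* D := MulSemiringAction.toRingHom (ConjAct Dˣ) D (ConjAct.toConjAct u)

theorem unitConj_apply (u : Dˣ) (x : D) : unitConj u x = u * x * ↑u⁻¹ := rfl

theorem unitConj_unitConj (u v : Dˣ) (x : D) :
    unitConj u (unitConj v x) = unitConj (u * v) x := by
  simp only [unitConj_apply, mul_inv_rev, Units.val_mul, mul_assoc]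

theorem unitConj_coe (u d : Dˣ) : unitConj u (d : D) = ((u * d * u⁻¹ : Dˣ) : D) := rfl

theorem eval_map_unitConj (u : Dˣ) (p : D[X]) (c : D) :
    (p.map (unitConj u)).eval (unitConj u c) = unitConj u (p.eval c) :=
  eval_map_apply _ _

/-- Among the monic polynomials vanishing on the whole conjugacy class of `d`, one of minimal
degree has all its coefficients in the centre. -/
theorem exists_monic_minimal_of_conjClass (d : D)
    (hd : ∃ p : D[X], p.Monic ∧ ∀ u : Dˣ, p.eval (unitConj u d) = 0) :
    ∃ h : D[X], h.Monic ∧ (∀ u : Dˣ, h.eval (unitConj u d) = 0) ∧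
      (∀ p : D[X], p ≠ 0 → (∀ u : Dˣ, p.eval (unitConj u d) = 0) → h.natDegree ≤ p.natDegree) ∧
      ∀ v : Dˣ, h.map (unitConj v) = h := by
  classical
  have hex : ∃ n, ∃ p : D[X], p.Monic ∧ (∀ u : Dˣ, p.eval (unitConj u d) = 0) ∧
      p.natDegree = n := by
    obtain ⟨p, h1, h2⟩ := hd
    exact ⟨_, p, h1, h2, rfl⟩
  obtain ⟨h, h1, h2, h3⟩ := Nat.find_spec hex
  have hmin : ∀ p : D[X], p ≠ 0 → (∀ u : Dˣ, p.eval (unitConj u d) = 0) →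
      h.natDegree ≤ p.natDegree := fun p hp hp' => by
    rw [h3]
    refine Nat.find_min' hex ⟨C p.leadingCoeff⁻¹ * p, ?_, fun u => ?_, ?_⟩
    · rw [Monic, leadingCoeff_mul, leadingCoeff_C, inv_mul_cancel₀ (leadingCoeff_ne_zero.2 hp)]
    · rw [eval_C_mul, hp' u, mul_zero]
    · exact natDegree_C_mul (inv_ne_zero (leadingCoeff_ne_zero.2 hp))
  refine ⟨h, h1, h2, hmin, fun v => ?_⟩
  by_contra hne
  -- the difference vanishes on the conjugacy class as well, and has smaller degree
  have hne' : h - h.map (unitConj v) ≠ 0 := fun h0 => hne (sub_eq_zero.1 h0).symm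
  have h4 : ∀ u : Dˣ, (h - h.map (unitConj v)).eval (unitConj u d) = 0 := fun u => by
    have : unitConj u d = unitConj v (unitConj (v⁻¹ * u) d) := by
      rw [unitConj_unitConj, mul_inv_cancel_left]
    rw [eval_sub, h2, this, eval_map_unitConj, h2, map_zero, sub_zero]
  have h5 := hmin _ hne' h4
  have h6 : (h - h.map (unitConj v)).degree < h.degree :=
    degree_sub_lt_left (degree_map h _).symm h1.ne_zero
      (by rw [h1.leadingCoeff, (h1.map _).leadingCoeff])
  exact absurd h5 (not_le.2 (natDegree_lt_natDegree hne' h6))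

/-- **Wedderburn's factorization**: the minimal monic polynomial `h` vanishing on the conjugacy
class of `d` is a product of factors `X - c` with `c` conjugate to `d`. The partial products are
recorded here only through their degree and the image of the constant coefficient under
a homomorphism to a commutative group. -/
theorem exists_conj_factor {A : Type*} [CommGroup A] (F : Dˣ →* A) (d : Dˣ) (h : D[X])
    (h2 : ∀ u : Dˣ, h.eval (unitConj u (d : D)) = 0)
    (hmin : ∀ p : D[X], p ≠ 0 → (∀ u : Dˣ, p.eval (unitConj u (d : D)) = 0) →
      h.natDegree ≤ p.natDegree) (k : ℕ) (hk : k ≤ h.natDegree) :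
    ∃ g p : D[X], h = g * p ∧ p.Monic ∧ p.natDegree = k ∧
      ∃ x : Dˣ, p.coeff 0 = x ∧ F x = F (-d) ^ k := by
  induction k with
  | zero => exact ⟨h, 1, by simp, monic_one, by simp, 1, by simp, by simp⟩
  | succ k ih =>
    obtain ⟨g, p, e, hp, hpd, x, hx, hFx⟩ := ih (by omega)
    -- `p` has too small a degree to vanish on the whole conjugacy class
    obtain ⟨u, hu⟩ : ∃ u : Dˣ, p.eval (unitConj u (d : D)) ≠ 0 := by
      by_contra! hall
      have := hmin p hp.ne_zero hall
      omega
    set y := p.eval (unitConj u (d : D)) with hy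
    have hg : g.eval (unitConj (Units.mk0 y hu * u) (d : D)) = 0 := by
      have h3 := h2 u
      rw [e, eval_mul_of_eval_ne_zero g p hu] at h3
      rw [← unitConj_unitConj]
      exact (mul_eq_zero.1 h3).resolve_right hu
    set w := Units.mk0 y hu * u
    obtain ⟨q, hq⟩ := exists_eq_mul_X_sub_C g (unitConj w (d : D))
    rw [hg, C_0, add_zero] at hq
    refine ⟨q, (X - C (unitConj w (d : D))) * p, by rw [← mul_assoc, ← hq, e],
      (monic_X_sub_C _).mul hp, ?_, w * (-d) * w⁻¹ * x, ?_, ?_⟩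
    · rw [(monic_X_sub_C _).natDegree_mul hp, natDegree_X_sub_C, hpd, add_comm]
    · rw [mul_coeff_zero, hx]
      simp [unitConj_apply]
    · rw [map_mul, map_mul, map_mul, mul_comm (F w), map_inv, mul_inv_cancel_right, hFx, pow_succ']

/-- A homomorphism from the multiplicative group of a division ring to a torsion-free commutative
group is trivial at `d` if it is trivial on the centre and some monic polynomial vanishes on the
conjugacy class of `d`: a power of `d` is then central modulo commutators. -/
theorem hom_units_eq_one {A : Type*} [CommGroup A] [IsMulTorsionFree A] (F : Dˣ →* A)
    (hF : ∀ z ∈ Subgroup.center Dˣ, F z = 1) (d : Dˣ)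
    (hd : ∃ p : D[X], p.Monic ∧ ∀ u : Dˣ, p.eval (unitConj u (d : D)) = 0) : F d = 1 := by
  obtain ⟨h, h1, h2, hmin, hc⟩ := exists_monic_minimal_of_conjClass (d : D) hd
  obtain ⟨g, p, e, hp, hpd, x, hx, hFx⟩ := exists_conj_factor F d h h2 hmin _ le_rfl
  have hg : g = 1 := by
    have hg1 : g.Monic := hp.of_mul_monic_right (e ▸ h1)
    have := hg1.natDegree_mul hp
    rw [← e, hpd] at this
    exact hg1.natDegree_eq_zero.1 (by omega)
  rw [hg, one_mul] at e
  have hx1 : F x = 1 := by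
    refine hF x (Subgroup.mem_center_iff.2 fun v => ?_)
    have h3 : unitConj v (x : D) = x := by
      rw [← hx, ← e, ← coeff_map, hc v]
    rw [unitConj_coe] at h3
    exact mul_inv_eq_iff_eq_mul.1 (Units.ext h3)
  have hn : h.natDegree ≠ 0 := fun h0 => by
    have h3 := h2 1
    rw [h1.natDegree_eq_zero.1 h0, eval_one] at h3
    exact one_ne_zero h3
  have h4 : F (-d) = 1 := (pow_eq_one_iff_left hn).1 (hFx.symm.trans hx1)
  have h5 : F (-1) = 1 := hF _ (Subgroup.mem_center_iff.2 fun v => by simp)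
  rw [← neg_neg d, ← neg_one_mul, map_mul, h4, h5, one_mul]

/-- The minimal polynomial of `d` over a central subfield vanishes on the conjugacy class of `d`. -/
theorem exists_monic_conjClass_of_isIntegral {K : Type*} [Field K] [Algebra K D] (d : D)
    (hd : IsIntegral K d) : ∃ p : D[X], p.Monic ∧ ∀ u : Dˣ, p.eval (unitConj u d) = 0 := by
  refine ⟨(minpoly K d).map (algebraMap K D), (minpoly.monic hd).map _, fun u => ?_⟩
  have h1 : ((minpoly K d).map (algebraMap K D)).map (unitConj u) =
      (minpoly K d).map (algebraMap K D) := by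
    rw [map_map]
    congr 1
    ext k
    simp [unitConj_apply, ← Algebra.commutes k]
  rw [← h1, eval_map_unitConj, eval_map_algebraMap, minpoly.aeval, map_zero]

end Polynomial

/-! ### Commutative quotients of general linear groups over division rings -/

namespace LinearEquiv

open Module

section Dilation

variable {K W : Type*} [DivisionRing K] [AddCommGroup W] [Module K W]

theorem dilation_cancel {f : Dual K W} {e : W} (h : f e = 1) {a b : K} (hab : a * b = 1) (x : W) :
    (x + f x • (a - 1) • e) + f (x + f x • (a - 1) • e) • (b - 1) • e = x := by
  have h1 : f (x + f x • (a - 1) • e) = f x * a := by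
    rw [map_add, _root_.map_smul, _root_.map_smul, h, smul_eq_mul, smul_eq_mul, mul_one,
      mul_sub, mul_one, add_sub_cancel]
  rw [h1, smul_smul, smul_smul, add_assoc, ← add_smul]
  have h2 : f x * (a - 1) + f x * a * (b - 1) = 0 := by
    rw [mul_sub, mul_sub, mul_assoc (f x) a b, hab, mul_one, mul_one, sub_add_sub_cancel, sub_self]
  rw [h2, zero_smul, add_zero]

/-- The dilation `x ↦ x + f(x) (a - 1) e` for a linear form `f` and a vector `e` with `f(e) = 1`: it
fixes `ker f` and sends `e` to `a e`. -/
def axisDilation (f : Dual K W) (e : W) (h : f e = 1) (a : Kˣ) : W ≃ₗ[K] W where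
  toFun x := x + f x • ((a : K) - 1) • e
  invFun x := x + f x • ((a⁻¹ : Kˣ) - 1 : K) • e
  map_add' x y := by rw [map_add, add_smul]; abel
  map_smul' c x := by simp [mul_smul]
  left_inv x := dilation_cancel h a.mul_inv x
  right_inv x := dilation_cancel h a.inv_mul x

theorem axisDilation_apply (f : Dual K W) (e : W) (h : f e = 1) (a : Kˣ) (x : W) :
    axisDilation f e h a x = x + f x • ((a : K) - 1) • e := rfl

theorem apply_axisDilation (f : Dual K W) (e : W) (h : f e = 1) (a : Kˣ) (x : W) :
    f (axisDilation f e h a x) = f x * a := by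
  rw [axisDilation_apply, map_add, _root_.map_smul, _root_.map_smul, h, smul_eq_mul, smul_eq_mul,
    mul_one, mul_sub, mul_one, add_sub_cancel]

theorem axisDilation_mul (f : Dual K W) (e : W) (h : f e = 1) (a b : Kˣ) :
    axisDilation f e h a * axisDilation f e h b = axisDilation f e h (b * a) := by
  ext x
  rw [mul_apply, axisDilation_apply, apply_axisDilation, axisDilation_apply, axisDilation_apply,
    add_assoc, smul_smul, smul_smul, smul_smul, ← add_smul, Units.val_mul]
  congr 2
  noncomm_ring

variable {A : Type*} [CommGroup A] (φ : (W ≃ₗ[K] W) →* A)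

theorem hom_eq_of_conj {g s t : W ≃ₗ[K] W} (h : ∀ x, g (s x) = t (g x)) : φ s = φ t := by
  have : g * s = t * g := LinearEquiv.ext h
  have := congrArg φ this
  rw [map_mul, map_mul, mul_comm] at this
  exact mul_right_cancel this

theorem hom_axisDilation_eq_of_conj {f f' : Dual K W} {e e' : W} (h : f e = 1) (h' : f' e' = 1)
    (a : Kˣ) (g : W ≃ₗ[K] W) (hf : ∀ x, f' (g x) = f x) (he : g e = e') :
    φ (axisDilation f e h a) = φ (axisDilation f' e' h' a) :=
  hom_eq_of_conj φ (g := g) fun x => by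
    rw [axisDilation_apply, axisDilation_apply, map_add, _root_.map_smul, _root_.map_smul, he, hf]

theorem hom_axisDilation_eq_of_same_form {f : Dual K W} {e e' : W} (h : f e = 1) (h' : f e' = 1)
    (a : Kˣ) : φ (axisDilation f e h a) = φ (axisDilation f e' h' a) := by
  have h0 : f (e' - e) = 0 := by rw [map_sub, h, h', sub_self]
  refine hom_axisDilation_eq_of_conj φ h h' a (transvection h0) (fun x => ?_) ?_
  · rw [transvection.apply, map_add, _root_.map_smul, h0, smul_zero, add_zero]
  · rw [transvection.apply, h, one_smul, add_sub_cancel]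

theorem hom_axisDilation_eq_of_same_vector {f f' : Dual K W} {e : W} (h : f e = 1) (h' : f' e = 1)
    (a : Kˣ) : φ (axisDilation f e h a) = φ (axisDilation f' e h' a) := by
  have h0 : (f - f') e = 0 := by rw [LinearMap.sub_apply, h, h', sub_self]
  refine hom_axisDilation_eq_of_conj φ h h' a (transvection h0) (fun x => ?_) ?_
  · rw [transvection.apply, map_add, _root_.map_smul, h', smul_eq_mul, mul_one, LinearMap.sub_apply,
      add_sub_cancel]
  · rw [transvection.apply, h0, zero_smul, add_zero]

theorem hom_axisDilation_eq_of_ne_zero {f f' : Dual K W} {e e' : W} (h : f e = 1)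
    (h' : f' e' = 1) (hne : f e' ≠ 0) (a : Kˣ) :
    φ (axisDilation f e h a) = φ (axisDilation f' e' h' a) := by
  have h1 : f ((f e')⁻¹ • e') = 1 := by rw [_root_.map_smul, smul_eq_mul, inv_mul_cancel₀ hne]
  have h2 : (f.smulRight (f e')⁻¹ : Dual K W) e' = 1 := by
    rw [LinearMap.smulRight_apply, smul_eq_mul, mul_inv_cancel₀ hne]
  rw [hom_axisDilation_eq_of_same_form φ h h1, ← hom_axisDilation_eq_of_same_vector φ h2 h']
  refine hom_axisDilation_eq_of_conj φ h1 h2 a (axisDilation f _ h1 (Units.mk0 _ hne))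
    (fun x => ?_) ?_
  · rw [LinearMap.smulRight_apply, apply_axisDilation, smul_eq_mul, Units.val_mk0, mul_assoc,
      mul_inv_cancel₀ hne, mul_one]
  · rw [axisDilation_apply, h1, one_smul, sub_smul, one_smul, add_sub_cancel, Units.val_mk0,
      smul_smul, mul_inv_cancel₀ hne, one_smul]

/-- All axis dilations of the same ratio are conjugate. -/
theorem hom_axisDilation_eq {f f' : Dual K W} {e e' : W} (h : f e = 1)
    (h' : f' e' = 1) (a : Kˣ) : φ (axisDilation f e h a) = φ (axisDilation f' e' h' a) := by
  by_cases h1 : f e' = 0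
  · by_cases h2 : f' e = 0
    · have h3 : f' (e + e') = 1 := by rw [map_add, h2, h', zero_add]
      rw [hom_axisDilation_eq_of_ne_zero φ h h3 (by simp [h, h1]),
        hom_axisDilation_eq_of_same_form φ h3 h']
    · exact (hom_axisDilation_eq_of_ne_zero φ h' h h2 a).symm
  · exact hom_axisDilation_eq_of_ne_zero φ h h' h1 a

/-- In characteristic zero, a transvection is conjugate to its own square root, so that it dies in
every commutative quotient. -/
theorem hom_transvection_eq_one [CharZero K] {f : Dual K W} {v : W} (h : f v = 0) :
    φ (transvection h) = 1 := by
  by_cases hf : f = 0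
  · have : transvection h = 1 := by
      ext x
      simp [hf]
    rw [this, map_one]
  obtain ⟨e₀, he₀⟩ : ∃ e, f e ≠ 0 := by
    by_contra! h0
    exact hf (LinearMap.ext h0)
  have he : f ((f e₀)⁻¹ • e₀) = 1 := by rw [_root_.map_smul, smul_eq_mul, inv_mul_cancel₀ he₀]
  have h2 : f ((2 : K)⁻¹ • v) = 0 := by rw [_root_.map_smul, h, smul_zero]
  have e1 : φ (transvection h) = φ (transvection h2) := by
    refine hom_eq_of_conj φ (g := axisDilation f _ he (Units.mk0 2 two_ne_zero)) fun x => ?_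
    rw [transvection.apply, transvection.apply, apply_axisDilation, map_add,
      _root_.map_smul, smul_smul, Units.val_mk0, mul_assoc, mul_inv_cancel₀ two_ne_zero, mul_one,
      axisDilation_apply f _ he _ v, h, zero_smul, add_zero]
  have e2 : transvection h = transvection h2 * transvection h2 := by
    ext x
    rw [mul_apply, transvection.apply, transvection.apply, transvection.apply, map_add,
      _root_.map_smul, h2, smul_zero, add_zero, add_assoc, ← smul_add, ← add_smul, ← one_div,
      add_halves, one_smul]
  have e3 := congrArg φ e2
  rw [map_mul, ← e1] at e3
  exact left_eq_mul.1 e3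

theorem hom_eq_one_of_mem_dilatransvections [CharZero K]
    (hφ : ∀ (f : Dual K W) (e : W) (h : f e = 1) (a : Kˣ), φ (axisDilation f e h a) = 1)
    {g : W ≃ₗ[K] W} (hg : g ∈ dilatransvections K W) : φ g = 1 := by
  obtain ⟨f, v, hfv⟩ := hg
  have hg : ∀ x, g x = x + f x • v := fun x => congrArg (fun l : W →ₗ[K] W => l x) hfv
  by_cases hv : f v = 0
  · have : g = transvection hv := LinearEquiv.ext fun x => by rw [hg, transvection.apply]
    rw [this, hom_transvection_eq_one]
  · have h1 : f ((f v)⁻¹ • v) = 1 := by rw [_root_.map_smul, smul_eq_mul, inv_mul_cancel₀ hv]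
    have hu : 1 + f v ≠ 0 := fun h0 => by
      have : g v = 0 := by
        rw [hg]
        nth_rewrite 1 [← one_smul K v]
        rw [← add_smul, h0, zero_smul]
      exact hv (by rw [g.map_eq_zero_iff.1 this, map_zero])
    have : g = axisDilation f _ h1 (Units.mk0 _ hu) := LinearEquiv.ext fun x => by
      rw [hg, axisDilation_apply, Units.val_mk0, add_sub_cancel_left, smul_smul (f v),
        mul_inv_cancel₀ hv, one_smul]
    rw [this, hφ]

/-- The general linear group of a finite-dimensional vector space over a division ring is generated
by dilatransvections: composing `g ≠ 1` with a suitable one enlarges the fixed subspace. -/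
theorem hom_eq_one_of_dilatransvections [FiniteDimensional K W]
    (hφ : ∀ g ∈ dilatransvections K W, φ g = 1) (g : W ≃ₗ[K] W) : φ g = 1 := by
  induction hn : finrank K W - finrank K g.fixedSubmodule using Nat.strong_induction_on
    generalizing g with
  | _ n ih =>
  by_cases htop : g.fixedSubmodule = ⊤
  · have : g = 1 := LinearEquiv.ext fun x => by
      have : x ∈ g.fixedSubmodule := htop ▸ Submodule.mem_top
      exact LinearMap.mem_fixedSubmodule_iff.1 this
    rw [this, map_one]
  obtain ⟨v, hv⟩ : ∃ v, v ∉ g.fixedSubmodule := by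
    by_contra! h0
    exact htop (eq_top_iff.2 fun x _ => h0 x)
  have hgv : g v ∉ g.fixedSubmodule := fun h0 =>
    hv (LinearMap.mem_fixedSubmodule_iff.2 (g.injective (LinearMap.mem_fixedSubmodule_iff.1 h0)))
  -- a linear form vanishing on the fixed subspace, but neither at `v` nor at `g v`
  obtain ⟨f, hfv, hfgv, hf⟩ : ∃ f : Dual K W, f v ≠ 0 ∧ f (g v) ≠ 0 ∧
      ∀ x ∈ g.fixedSubmodule, f x = 0 := by
    obtain ⟨f₁, h1, h1'⟩ := Submodule.exists_le_ker_of_notMem hv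
    obtain ⟨f₂, h2, h2'⟩ := Submodule.exists_le_ker_of_notMem hgv
    by_cases h3 : f₁ (g v) = 0
    · by_cases h4 : f₂ v = 0
      · exact ⟨f₁ + f₂, by simpa [h4] using h1, by simpa [h3] using h2, fun x hx => by
          rw [LinearMap.add_apply, LinearMap.mem_ker.1 (h1' hx), LinearMap.mem_ker.1 (h2' hx),
            add_zero]⟩
      · exact ⟨f₂, h4, h2, fun x hx => h2' hx⟩
    · exact ⟨f₁, h1, h3, fun x hx => h1' hx⟩
  set c := f (g v) with hc
  have hunit : IsUnit (1 + f (c⁻¹ • (v - g v))) := by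
    rw [_root_.map_smul, map_sub, ← hc, smul_eq_mul, mul_sub, inv_mul_cancel₀ hfgv, add_sub_cancel]
    exact (mul_ne_zero (inv_ne_zero hfgv) hfv).isUnit
  set t := dilatransvection hunit with ht
  have htmem : t ∈ dilatransvections K W := dilatransvection_mem_dilatransvections
  have hfix : g.fixedSubmodule < (t * g).fixedSubmodule := by
    refine SetLike.lt_iff_le_and_exists.2 ⟨fun x hx => ?_, v, ?_, hv⟩
    · have hx' : g x = x := LinearMap.mem_fixedSubmodule_iff.1 hx
      refine LinearMap.mem_fixedSubmodule_iff.2 ?_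
      change t (g x) = x
      rw [hx', dilatransvection.apply, hf x hx, zero_smul, add_zero]
    · refine LinearMap.mem_fixedSubmodule_iff.2 ?_
      change t (g v) = v
      rw [dilatransvection.apply, ← hc, smul_smul, mul_inv_cancel₀ hfgv, one_smul, add_sub_cancel]
  have hlt := Submodule.finrank_lt_finrank_of_lt hfix
  have hle := Submodule.finrank_le (t * g).fixedSubmodule
  have := ih _ (by omega) (t * g) rfl
  rwa [map_mul, hφ t htmem, one_mul] at this

end Dilation

section Standard

open scoped IsMulCommutative

variable {K : Type*} [DivisionRing K] {ι : Type*}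

/-- The diagonal action of central units on `ι → K`. -/
def centralDiagonal : (ι → Subgroup.center Kˣ) →* ((ι → K) ≃ₗ[K] (ι → K)) where
  toFun c :=
    { toFun := fun x i => x i * (c i : Kˣ)
      invFun := fun x i => x i * ((c i : Kˣ)⁻¹ : Kˣ)
      map_add' := fun x y => funext fun i => add_mul _ _ _
      map_smul' := fun a x => funext fun i => mul_assoc _ _ _
      left_inv := fun x => funext fun i => by simp
      right_inv := fun x => funext fun i => by simp }
  map_one' := by ext x; simp
  map_mul' c d := by
    ext x : 1
    funext i
    change x i * ((c i * d i : Subgroup.center Kˣ) : Kˣ) = x i * (d i : Kˣ) * (c i : Kˣ)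
    rw [mul_comm (c i), Subgroup.coe_mul, Units.val_mul, mul_assoc]

theorem centralDiagonal_apply (c : ι → Subgroup.center Kˣ) (x : ι → K) (i : ι) :
    centralDiagonal c x i = x i * (c i : Kˣ) := rfl

theorem unit_center_comm (z : Subgroup.center Kˣ) (k : K) : ((z : Kˣ) : K) * k = k * (z : Kˣ) := by
  by_cases hk : k = 0
  · simp [hk]
  · exact (congrArg Units.val (Subgroup.mem_center_iff.1 z.2 (Units.mk0 k hk))).symm

theorem centralDiagonal_const_mem_center (z : Subgroup.center Kˣ) :
    centralDiagonal (fun _ : ι => z) ∈ Subgroup.center ((ι → K) ≃ₗ[K] (ι → K)) := by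
  have h : ∀ x : ι → K, centralDiagonal (fun _ : ι => z) x = ((z : Kˣ) : K) • x := fun x =>
    funext fun i => (unit_center_comm z (x i)).symm
  refine Subgroup.mem_center_iff.2 fun g => LinearEquiv.ext fun x => ?_
  rw [mul_apply, mul_apply, h, h, _root_.map_smul]

theorem centralDiagonal_mulSingle [DecidableEq ι] (i : ι) (z : Subgroup.center Kˣ)
    (h : (LinearMap.proj i : Dual K (ι → K)) (Pi.single i 1) = 1) :
    centralDiagonal (Pi.mulSingle i z) = axisDilation _ _ h (z : Kˣ) := by
  ext x : 1
  funext j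
  rw [centralDiagonal_apply, axisDilation_apply]
  by_cases hj : j = i
  · subst hj
    simp [mul_sub]
  · simp [hj]

/-- A homomorphism from the general linear group of a finite-dimensional vector space over a
division ring, algebraic over a central subfield and of characteristic zero, to a torsion-free
commutative group is trivial as soon as it is trivial on the centre. -/
theorem hom_eq_one_of_center [Fintype ι] {k : Type*} [Field k] [CharZero K] [Algebra k K]
    [Algebra.IsIntegral k K] {A : Type*} [CommGroup A] [IsMulTorsionFree A]
    (φ : ((ι → K) ≃ₗ[K] (ι → K)) →* A) (hφ : ∀ z ∈ Subgroup.center _, φ z = 1)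
    (g : (ι → K) ≃ₗ[K] (ι → K)) : φ g = 1 := by
  classical
  rcases isEmpty_or_nonempty ι with hι | hι
  · rw [Subsingleton.elim g 1, map_one]
  obtain ⟨i₀⟩ := id hι
  have h1 : ∀ i : ι, (LinearMap.proj i : Dual K (ι → K)) (Pi.single i 1) = 1 := fun i => by simp
  -- the ratio determines the image of a dilation, giving a homomorphism on `Kˣ`
  let F : Kˣ →* A :=
    { toFun := fun a => φ (axisDilation _ _ (h1 i₀) a)
      map_one' := by
        convert map_one φ
        ext x : 1
        simp [axisDilation_apply]
      map_mul' := fun a b => by rw [← axisDilation_mul, map_mul, mul_comm] }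
  have hF : ∀ z ∈ Subgroup.center Kˣ, F z = 1 := fun z hz => by
    have h2 := hφ _ (centralDiagonal_const_mem_center (ι := ι) ⟨z, hz⟩)
    have h3 : (fun _ : ι => (⟨z, hz⟩ : Subgroup.center Kˣ)) =
        ∏ i, Pi.mulSingle i (⟨z, hz⟩ : Subgroup.center Kˣ) :=
      (Finset.univ_prod_mulSingle fun _ : ι => (⟨z, hz⟩ : Subgroup.center Kˣ)).symm
    have h4 : ∀ i : ι, φ (centralDiagonal (Pi.mulSingle i ⟨z, hz⟩)) = F z := fun i => by
      rw [centralDiagonal_mulSingle i _ (h1 i)]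
      exact hom_axisDilation_eq φ _ _ _
    have h5 : (φ.comp centralDiagonal) (fun _ : ι => (⟨z, hz⟩ : Subgroup.center Kˣ)) =
        F z ^ Fintype.card ι := by
      rw [h3, map_prod]
      simp [h4]
    exact (pow_eq_one_iff_left Fintype.card_ne_zero).1 (h5.symm.trans h2)
  refine hom_eq_one_of_dilatransvections φ (fun t ht => ?_) g
  refine hom_eq_one_of_mem_dilatransvections φ (fun f e h a => ?_) ht
  rw [hom_axisDilation_eq φ h (h1 i₀)]
  exact Polynomial.hom_units_eq_one F hF a
    (Polynomial.exists_monic_conjClass_of_isIntegral (K := k) (a : K)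
      (Algebra.IsIntegral.isIntegral _))

end Standard

end LinearEquiv

/-! ### Commutative quotients of automorphism groups of semisimple modules -/

open Module

/-- Every homomorphism from `G` to `A` that is trivial on the centre of `G` is trivial. -/
def CentralHomTrivial (G A : Type*) [Group G] [CommGroup A] : Prop :=
  ∀ φ : G →* A, (∀ z ∈ Subgroup.center G, φ z = 1) → ∀ g, φ g = 1

namespace CentralHomTrivial

variable {A : Type*} [CommGroup A]

theorem of_mulEquiv {G H : Type*} [Group G] [Group H] (e : G ≃* H) (h : CentralHomTrivial H A) :
    CentralHomTrivial G A := fun φ hφ g => by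
  have := h (φ.comp e.symm.toMonoidHom) (fun z hz => hφ _ (Subgroup.mem_center_iff.2 fun x => by
    apply e.injective
    simpa using Subgroup.mem_center_iff.1 hz (e x))) (e g)
  simpa using this

theorem pi {ι : Type*} [Finite ι] {G : ι → Type*} [∀ i, Group (G i)]
    (h : ∀ i, CentralHomTrivial (G i) A) : CentralHomTrivial (∀ i, G i) A := fun φ hφ g => by
  classical
  have := Fintype.ofFinite ι
  have h1 : ∀ i (x : G i), φ (Pi.mulSingle i x) = 1 := fun i x => by
    refine h i (φ.comp (MonoidHom.mulSingle G i)) (fun z hz => hφ _ ?_) x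
    refine Subgroup.mem_center_iff.2 fun y => funext fun j => ?_
    by_cases hj : j = i
    · subst hj
      simpa using Subgroup.mem_center_iff.1 hz (y j)
    · simp [hj]
  have h2 : φ = 1 := MonoidHom.pi_ext fun i x => h1 i x
  rw [h2, MonoidHom.one_apply]

end CentralHomTrivial

/-- The matrix ring over `D` as the endomorphism ring of a left vector space over `Dᵐᵒᵖ`. -/
noncomputable def matrixEquivEndMulOpposite (ι D : Type*) [Fintype ι] [DecidableEq ι]
    [DivisionRing D] : Matrix ι ι D ≃+* Module.End Dᵐᵒᵖ (ι → Dᵐᵒᵖ) :=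
  ((RingEquiv.opOp D).trans (RingEquiv.moduleEndSelf Dᵐᵒᵖ)).mapMatrix.trans
    (endVecRingEquivMatrixEnd ι Dᵐᵒᵖ Dᵐᵒᵖ).symm

/-- Let `V` be a semisimple module of finite length over an algebra over a field of characteristic
zero, finite-dimensional over that field. A homomorphism from `Aut V` to a torsion-free commutative
group which is trivial on the centre is trivial: by Wedderburn–Artin, `Aut V` is a product of
general linear groups over division algebras. -/
theorem CentralHomTrivial.linearEquiv (k : Type*) {R V A : Type*} [Field k] [CharZero k] [Ring R]
    [Algebra k R] [AddCommGroup V] [Module R V] [Module k V] [IsScalarTower k R V]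
    [IsSemisimpleModule R V] [Module.Finite R V] [Module.Finite k V] [CommGroup A]
    [IsMulTorsionFree A] : CentralHomTrivial (V ≃ₗ[R] V) A := by
  have : IsSemisimpleRing (Module.End R V) := IsSemisimpleRing.moduleEnd R V
  have : Module.Finite k (Module.End R V) := by
    let f : Module.End R V →ₗ[k] Module.End k V :=
      { toFun := fun g => g.restrictScalars k
        map_add' := fun _ _ => rfl
        map_smul' := fun _ _ => rfl }
    refine Module.Finite.of_injective f fun g g' h => LinearMap.ext fun x => ?_
    exact LinearMap.congr_fun h x
  obtain ⟨n, D, d, _, _, hfin, hd, ⟨e⟩⟩ :=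
    IsSemisimpleRing.exists_algEquiv_pi_matrix_divisionRing_finite k (Module.End R V)
  let e1 : (V ≃ₗ[R] V) ≃* (Module.End R V)ˣ :=
    (LinearMap.GeneralLinearGroup.generalLinearEquiv R V).symm
  let e2 := e1.trans ((Units.mapEquiv e.toMulEquiv).trans MulEquiv.piUnits)
  refine .of_mulEquiv e2 (.pi fun i => ?_)
  have : CharZero (D i)ᵐᵒᵖ :=
    charZero_of_injective_algebraMap (FaithfulSMul.algebraMap_injective k (D i)ᵐᵒᵖ)
  have : Module.Finite k (D i)ᵐᵒᵖ := Module.Finite.equiv (MulOpposite.opLinearEquiv k)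
  let e3 := Units.mapEquiv (matrixEquivEndMulOpposite (Fin (d i)) (D i)).toMulEquiv
  refine .of_mulEquiv (e3.trans
    (LinearMap.GeneralLinearGroup.generalLinearEquiv (D i)ᵐᵒᵖ (Fin (d i) → (D i)ᵐᵒᵖ))) ?_
  exact fun φ hφ g => LinearEquiv.hom_eq_one_of_center (k := k) φ hφ g

/-! ### Finiteness statements for automorphisms of finitely generated modules -/

section Finiteness

variable {R M : Type*} [Ring R] [AddCommGroup M] [Module R M]

/-- The submodule `n M` of a module `M`. -/
def nsmulSubmodule (R M : Type*) [Ring R] [AddCommGroup M] [Module R M] (n : ℕ) : Submodule R M :=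
  LinearMap.range (n • (LinearMap.id : M →ₗ[R] M))

theorem mem_nsmulSubmodule {n : ℕ} {x : M} : x ∈ nsmulSubmodule R M n ↔ ∃ y, n • y = x := Iff.rfl

theorem map_nsmulSubmodule (n : ℕ) (σ : M ≃ₗ[R] M) :
    (nsmulSubmodule R M n).map (σ : M →ₗ[R] M) = nsmulSubmodule R M n := by
  ext x
  constructor
  · rintro ⟨_, ⟨y, rfl⟩, rfl⟩
    exact ⟨σ y, by simp⟩
  · rintro ⟨y, rfl⟩
    exact ⟨n • σ.symm y, ⟨σ.symm y, rfl⟩, by simp⟩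

/-- The action of `Aut M` on `M / n M`. -/
def autQuotient (R M : Type*) [Ring R] [AddCommGroup M] [Module R M] (n : ℕ) :
    (M ≃ₗ[R] M) →* Equiv.Perm (M ⧸ nsmulSubmodule R M n) where
  toFun σ := (Submodule.Quotient.equiv _ _ σ (map_nsmulSubmodule n σ)).toEquiv
  map_one' := Equiv.ext fun q => by
    induction q using Submodule.Quotient.induction_on with
    | H x => rfl
  map_mul' σ τ := Equiv.ext fun q => by
    induction q using Submodule.Quotient.induction_on with
    | H x => rfl

theorem mem_ker_autQuotient {n : ℕ} {σ : M ≃ₗ[R] M} :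
    σ ∈ (autQuotient R M n).ker ↔ ∀ x, ∃ y, n • y = σ x - x := by
  rw [MonoidHom.mem_ker]
  constructor
  · intro h x
    have h1 : (Submodule.Quotient.mk (σ x) : M ⧸ nsmulSubmodule R M n) = Submodule.Quotient.mk x :=
      Equiv.ext_iff.1 h (Submodule.Quotient.mk x)
    exact mem_nsmulSubmodule.1 ((Submodule.Quotient.eq _).1 h1)
  · refine fun h => Equiv.ext fun q => ?_
    induction q using Submodule.Quotient.induction_on with
    | H x => exact (Submodule.Quotient.eq _).2 (mem_nsmulSubmodule.2 (h x))

theorem finite_quotient_of_forall_zsmul_mem [Module.Finite ℤ M] (L : Submodule R M)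
    (h : ∀ x : M, ∃ n : ℤ, n ≠ 0 ∧ n • x ∈ L) : Finite (M ⧸ L) := by
  have : Module.Finite ℤ (M ⧸ L) :=
    Module.Finite.of_surjective (L.mkQ.toAddMonoidHom.toIntLinearMap) (L.mkQ_surjective)
  refine Module.finite_of_fg_torsion _ fun q => ?_
  induction q using Submodule.Quotient.induction_on with
  | H x =>
    obtain ⟨n, hn, hx⟩ := h x
    refine ⟨⟨n, mem_nonZeroDivisors_of_ne_zero hn⟩, ?_⟩
    exact (Submodule.Quotient.mk_eq_zero L).2 hx

theorem finiteIndex_of_forall_zsmul_mem [Module.Finite ℤ M] (L : Submodule R M)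
    (h : ∀ x : M, ∃ n : ℤ, n ≠ 0 ∧ n • x ∈ L) : L.toAddSubgroup.FiniteIndex :=
  have : Finite (M ⧸ L.toAddSubgroup) := finite_quotient_of_forall_zsmul_mem L h
  AddSubgroup.finiteIndex_of_finite_quotient

/-- The congruence subgroup of automorphisms that are trivial modulo `n` has finite index. -/
theorem finiteIndex_ker_autQuotient [Module.Finite ℤ M] {n : ℕ} (hn : n ≠ 0) :
    (autQuotient R M n).ker.FiniteIndex := by
  have : Finite (M ⧸ nsmulSubmodule R M n) := finite_quotient_of_forall_zsmul_mem _ fun x =>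
    ⟨n, Nat.cast_ne_zero.2 hn, x, (natCast_zsmul x n).symm⟩
  exact Subgroup.finiteIndex_ker _

theorem ker_autQuotient_le_autStabilizer (L : Submodule R M) :
    (autQuotient R M L.toAddSubgroup.index).ker ≤ autStabilizer L := by
  have key : ∀ σ ∈ (autQuotient R M L.toAddSubgroup.index).ker, L.map (σ : M →ₗ[R] M) ≤ L := by
    rintro σ hσ _ ⟨x, hx, rfl⟩
    obtain ⟨y, hy⟩ := mem_ker_autQuotient.1 hσ x
    have h1 : σ x = L.toAddSubgroup.index • y + x := by rw [hy, sub_add_cancel]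
    change σ x ∈ L
    rw [h1]
    exact L.add_mem (L.toAddSubgroup.nsmul_index_mem y) hx
  refine fun σ hσ => le_antisymm (key σ hσ) fun x hx => ?_
  exact ⟨σ⁻¹ x, key σ⁻¹ (inv_mem hσ) ⟨x, hx, rfl⟩, σ.apply_symm_apply x⟩

theorem finiteIndex_autStabilizer [Module.Finite ℤ M] (L : Submodule R M)
    (hL : L.toAddSubgroup.FiniteIndex) : (autStabilizer L).FiniteIndex :=
  have := finiteIndex_ker_autQuotient (R := R) (M := M) hL.index_ne_zero
  Subgroup.finiteIndex_of_le (ker_autQuotient_le_autStabilizer L)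

/-- A finitely generated abelian group has only finitely many torsion elements. -/
theorem exists_nsmul_torsion_eq_zero (M : Type*) [AddCommGroup M] [Module.Finite ℤ M] :
    Finite (Submodule.torsion ℤ M) ∧
      ∃ m : ℕ, m ≠ 0 ∧ ∀ x : M, (∃ n : ℤ, n ≠ 0 ∧ n • x = 0) → m • x = 0 := by
  have hfin : Finite (Submodule.torsion ℤ M) :=
    Module.finite_of_fg_torsion _ (Submodule.torsion_isTorsion)
  refine ⟨hfin, Nat.card (Submodule.torsion ℤ M), Nat.card_pos.ne', ?_⟩
  rintro x ⟨n, hn, hx⟩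
  have h1 : x ∈ Submodule.torsion ℤ M := ⟨⟨n, mem_nonZeroDivisors_of_ne_zero hn⟩, hx⟩
  exact congrArg Subtype.val (card_nsmul_eq_zero' (x := (⟨x, h1⟩ : Submodule.torsion ℤ M)))

/-- A group of automorphisms that are trivial modulo torsion is finite. -/
theorem finite_of_forall_sub_torsion [Module.Finite ℤ M] (K : Subgroup (M ≃ₗ[R] M))
    (hK : ∀ σ ∈ K, ∀ x, ∃ n : ℤ, n ≠ 0 ∧ n • (σ x - x) = 0) : Finite K := by
  obtain ⟨hfin, -⟩ := exists_nsmul_torsion_eq_zero M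
  obtain ⟨s, hs⟩ := (Module.Finite.fg_top : (⊤ : Submodule ℤ M).FG)
  let f : K → (s → Submodule.torsion ℤ M) := fun σ x => ⟨σ.1 x - x, by
    obtain ⟨n, hn, h⟩ := hK σ.1 σ.2 x
    exact ⟨⟨n, mem_nonZeroDivisors_of_ne_zero hn⟩, h⟩⟩
  refine Finite.of_injective f fun σ τ h => Subtype.ext (LinearEquiv.ext fun x => ?_)
  have h1 : (σ.1 : M →ₗ[R] M).toAddMonoidHom.toIntLinearMap =
      (τ.1 : M →ₗ[R] M).toAddMonoidHom.toIntLinearMap :=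
    LinearMap.ext_on hs fun y hy => sub_left_injective (congrArg Subtype.val (congrFun h ⟨y, hy⟩))
  exact LinearMap.congr_fun h1 x

theorem finite_ker_autRestrict [Module.Finite ℤ M] (L : Submodule R M)
    (hL : L.toAddSubgroup.FiniteIndex) : Finite (autRestrict L).ker := by
  have h1 : Finite ((autRestrict L).ker.map (autStabilizer L).subtype) := by
    refine finite_of_forall_sub_torsion _ ?_
    rintro _ ⟨σ, hσ, rfl⟩ x
    refine ⟨L.toAddSubgroup.index, Nat.cast_ne_zero.2 hL.index_ne_zero, ?_⟩
    have hx : L.toAddSubgroup.index • x ∈ L := L.toAddSubgroup.nsmul_index_mem x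
    have h2 : σ.1 (L.toAddSubgroup.index • x) = L.toAddSubgroup.index • x :=
      congrArg Subtype.val (LinearEquiv.congr_fun hσ ⟨_, hx⟩)
    rw [natCast_zsmul, smul_sub, ← map_nsmul]
    exact sub_eq_zero.2 h2
  exact Finite.of_equiv _
    ((autRestrict L).ker.equivMapOfInjective _ (autStabilizer L).subtype_injective).symm.toEquiv

/-- An automorphism `τ` of `L` that is congruent to the identity modulo `n m`, where `n = (M : L)`
and `m` kills the torsion of `M`, extends to `M`: multiplication by `n` is injective on `m L`, so
that `(τ - 1)(n x) / n` makes sense for `x ∈ M` as an element of `m L`. -/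
theorem ker_autQuotient_le_range_autRestrict (L : Submodule R M)
    (hL : L.toAddSubgroup.FiniteIndex) {m : ℕ}
    (hm : ∀ x : M, (∃ n : ℤ, n ≠ 0 ∧ n • x = 0) → m • x = 0) :
    (autQuotient R L (L.toAddSubgroup.index * m)).ker ≤ (autRestrict L).range := by
  intro τ hτ
  have hn0 := hL.index_ne_zero
  have hnL : ∀ x, L.toAddSubgroup.index • x ∈ L := L.toAddSubgroup.nsmul_index_mem
  set n := L.toAddSubgroup.index
  have hex : ∀ x : M, ∃ w : L, (n * m) • w = τ ⟨n • x, hnL x⟩ - ⟨n • x, hnL x⟩ := fun x =>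
    mem_ker_autQuotient.1 hτ _
  choose w hw using hex
  have hw' : ∀ x, n • m • (w x : M) = τ ⟨n • x, hnL x⟩ - n • x := fun x => by
    rw [smul_smul]
    exact congrArg Subtype.val (hw x)
  have huniq : ∀ a b : M, n • m • a = n • m • b → m • a = m • b := fun a b h => by
    have : m • (a - b) = 0 := by
      by_cases hm0 : m = 0
      · simp [hm0]
      refine hm _ ⟨(n * m : ℕ), Nat.cast_ne_zero.2 (mul_ne_zero hn0 hm0), ?_⟩
      rw [natCast_zsmul, mul_smul, smul_sub, smul_sub, h, sub_self]
    rwa [smul_sub, sub_eq_zero] at this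
  let δ : M →ₗ[R] M :=
    { toFun := fun x => m • (w x : M)
      map_add' := fun x y => by
        rw [← smul_add]
        refine huniq _ _ ?_
        have h1 : (⟨n • (x + y), hnL _⟩ : L) = ⟨n • x, hnL x⟩ + ⟨n • y, hnL y⟩ :=
          Subtype.ext (smul_add _ _ _)
        rw [hw', h1, smul_add n x y, smul_add m, smul_add n (m • _), hw', hw', map_add,
          Submodule.coe_add]
        abel
      map_smul' := fun r x => by
        rw [RingHom.id_apply, smul_comm r m]
        refine huniq _ _ ?_
        have h1 : (⟨n • r • x, hnL _⟩ : L) = r • ⟨n • x, hnL x⟩ :=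
          Subtype.ext (smul_comm _ _ _)
        rw [hw', h1, smul_comm n r x, smul_comm m r, smul_comm n r (m • _), hw', map_smul,
          Submodule.coe_smul, smul_sub] }
  have hδ : ∀ x, δ x ∈ L := fun x => L.smul_of_tower_mem m (w x).2
  have hδL : ∀ x : L, δ x = τ x - x := fun x => by
    obtain ⟨y, hy⟩ := mem_ker_autQuotient.1 hτ x
    have h1 : m • (w x : M) = m • ((n • y : L) : M) := by
      refine huniq _ _ ?_
      have h2 : (⟨n • (x : M), hnL x⟩ : L) = n • x := rfl
      rw [hw', h2, map_nsmul]
      have h3 := congrArg (fun z : L => n • (z : M)) hy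
      simp only [Submodule.coe_smul_of_tower, Submodule.coe_sub, smul_sub] at h3 ⊢
      rw [← h3, mul_comm n m, mul_smul]
    change m • (w x : M) = _
    rw [h1, ← Submodule.coe_sub, ← hy, mul_comm n m, mul_smul]
    rfl
  let σ₀ : M →ₗ[R] M := LinearMap.id + δ
  have hσ₀ : ∀ x, σ₀ x = x + δ x := fun _ => rfl
  have hσL : ∀ x : L, σ₀ x = τ x := fun x => by rw [hσ₀, hδL, add_sub_cancel]
  have hbij : Function.Bijective σ₀ := by
    constructor
    · refine (injective_iff_map_eq_zero σ₀).2 fun x hx => ?_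
      have h1 : x ∈ L := by
        have : x = -δ x := eq_neg_of_add_eq_zero_left hx
        rw [this]
        exact L.neg_mem (hδ x)
      have h2 := hσL ⟨x, h1⟩
      rw [hx] at h2
      have h3 : τ ⟨x, h1⟩ = 0 := Subtype.ext h2.symm
      exact congrArg Subtype.val (τ.map_eq_zero_iff.1 h3)
    · intro z
      refine ⟨z - τ.symm ⟨δ z, hδ z⟩, ?_⟩
      rw [map_sub, hσL, LinearEquiv.apply_symm_apply, hσ₀, add_sub_cancel_right]
  let σ := LinearEquiv.ofBijective σ₀ hbij
  have hσ : σ ∈ autStabilizer L := by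
    refine le_antisymm ?_ fun x hx => ?_
    · rintro _ ⟨x, hx, rfl⟩
      change σ₀ (⟨x, hx⟩ : L) ∈ L
      rw [hσL]
      exact (τ _).2
    · refine ⟨τ.symm ⟨x, hx⟩, (τ.symm ⟨x, hx⟩).2, ?_⟩
      change σ₀ _ = x
      rw [hσL, LinearEquiv.apply_symm_apply]
  exact ⟨⟨σ, hσ⟩, LinearEquiv.ext fun x => Subtype.ext (hσL x)⟩

theorem finiteIndex_range_autRestrict [Module.Finite ℤ M] (L : Submodule R M)
    (hL : L.toAddSubgroup.FiniteIndex) : (autRestrict L).range.FiniteIndex := by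
  obtain ⟨-, m, hm0, hm⟩ := exists_nsmul_torsion_eq_zero M
  have : Module.Finite ℤ L :=
    Module.Finite.of_injective L.subtype.toAddMonoidHom.toIntLinearMap Subtype.val_injective
  have := finiteIndex_ker_autQuotient (R := R) (M := L) (mul_ne_zero hL.index_ne_zero hm0)
  exact Subgroup.finiteIndex_of_le (ker_autQuotient_le_range_autRestrict L hL hm)

end Finiteness

/-! ### Extension of scalars from the integers to the rationals -/

section RatExt

variable {G : Type*} [Group G]
variable {L : Type*} [AddCommGroup L] [Module (MonoidAlgebra ℤ G) L]
variable {M : Type*} [AddCommGroup M] [Module (MonoidAlgebra ℤ G) M]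

/-- The canonical map `L → ℚ ⊗ L`. -/
noncomputable def ratMk (G : Type*) [Group G] {L : Type*} [AddCommGroup L]
    [Module (MonoidAlgebra ℤ G) L] : L →+ RatExt G L :=
  (TensorProduct.mk ℤ ℚ L 1).toAddMonoidHom

theorem ratMk_eq_zero_iff {x : L} : ratMk G x = 0 ↔ ∃ n : ℤ, n ≠ 0 ∧ n • x = 0 := by
  refine (IsLocalizedModule.eq_zero_iff (nonZeroDivisors ℤ) (TensorProduct.mk ℤ ℚ L 1)).trans ?_
  constructor
  · rintro ⟨n, hn⟩
    exact ⟨n, nonZeroDivisors.coe_ne_zero n, hn⟩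
  · rintro ⟨n, hn, h⟩
    exact ⟨⟨n, mem_nonZeroDivisors_of_ne_zero hn⟩, h⟩

theorem exists_zsmul_eq_ratMk (v : RatExt G L) : ∃ n : ℤ, n ≠ 0 ∧ ∃ x : L, n • v = ratMk G x := by
  obtain ⟨⟨x, n⟩, h⟩ := IsLocalizedModule.surj (nonZeroDivisors ℤ) (TensorProduct.mk ℤ ℚ L 1) v
  exact ⟨n, nonZeroDivisors.coe_ne_zero n, x, h⟩

theorem ratMk_smul (a : MonoidAlgebra ℤ G) (x : L) :
    ratMk G (a • x) = MonoidAlgebra.mapRingHom G (Int.castRingHom ℚ) a • ratMk G x := by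
  induction a using MonoidAlgebra.induction_linear with
  | zero => simp
  | add a b ha hb => simp only [add_smul, map_add, ha, hb]
  | single g r =>
    rw [MonoidAlgebra.mapRingHom_single]
    change (1 : ℚ) ⊗ₜ[ℤ] (MonoidAlgebra.single g r • x) =
      ratAction G L (MonoidAlgebra.single g (r : ℚ)) ((1 : ℚ) ⊗ₜ[ℤ] x)
    have h1 : MonoidAlgebra.single g r = r • MonoidAlgebra.of ℤ G g := by simp
    have h2 : ratAction G L (MonoidAlgebra.single g (r : ℚ)) ((1 : ℚ) ⊗ₜ[ℤ] x) =
        (r : ℚ) • (1 : ℚ) ⊗ₜ[ℤ] (MonoidAlgebra.of ℤ G g • x) := by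
      simp [ratAction, intAction]
    rw [h1, h2, smul_assoc, TensorProduct.tmul_smul, Int.cast_smul_eq_zsmul]

theorem baseChange_ratAction (f : L →ₗ[MonoidAlgebra ℤ G] M) (a : MonoidAlgebra ℚ G)
    (t : ℚ ⊗[ℤ] L) :
    f.toAddMonoidHom.toIntLinearMap.baseChange ℚ (ratAction G L a t) =
      ratAction G M a (f.toAddMonoidHom.toIntLinearMap.baseChange ℚ t) := by
  induction a using MonoidAlgebra.induction_linear with
  | zero => simp
  | add x y hx hy => simp [hx, hy]
  | single g r =>
    induction t using TensorProduct.induction_on with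
    | zero => simp
    | add x y hx hy => simp only [map_add, hx, hy]
    | tmul q x => simp [ratAction, intAction]

/-- The `ℚ[G]`-linear extension of a `ℤ[G]`-linear map. -/
noncomputable def ratMap (f : L →ₗ[MonoidAlgebra ℤ G] M) :
    RatExt G L →ₗ[MonoidAlgebra ℚ G] RatExt G M where
  toFun := f.toAddMonoidHom.toIntLinearMap.baseChange ℚ
  map_add' := map_add _
  map_smul' := baseChange_ratAction f

theorem ratMap_ratMk (f : L →ₗ[MonoidAlgebra ℤ G] M) (x : L) :
    ratMap f (ratMk G x) = ratMk G (f x) := rfl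

variable {V : Type*} [AddCommGroup V] [Module (MonoidAlgebra ℚ G) V]

theorem zsmul_eq_algebraMap_smul (n : ℤ) (v : V) :
    n • v = algebraMap ℚ (MonoidAlgebra ℚ G) n • v := by
  rw [map_intCast, Int.cast_smul_eq_zsmul]

theorem exists_zsmul_eq (G : Type*) [Group G] {V : Type*} [AddCommGroup V]
    [Module (MonoidAlgebra ℚ G) V] {n : ℤ} (hn : n ≠ 0) (v : V) : ∃ w : V, n • w = v :=
  ⟨algebraMap ℚ (MonoidAlgebra ℚ G) (n : ℚ)⁻¹ • v, by
    rw [zsmul_eq_algebraMap_smul (G := G), smul_smul, ← map_mul,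
      mul_inv_cancel₀ (Int.cast_ne_zero.2 hn), map_one, one_smul]⟩

theorem zsmul_injective_of_rat (G : Type*) [Group G] {V : Type*} [AddCommGroup V]
    [Module (MonoidAlgebra ℚ G) V] {n : ℤ} (hn : n ≠ 0) {v w : V} (h : n • v = n • w) : v = w := by
  have h1 := congrArg (fun u => algebraMap ℚ (MonoidAlgebra ℚ G) (n : ℚ)⁻¹ • u) h
  simpa only [zsmul_eq_algebraMap_smul (G := G), smul_smul, ← map_mul,
    inv_mul_cancel₀ (Int.cast_ne_zero.2 hn : (n : ℚ) ≠ 0), map_one, one_smul] using h1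

theorem ratExt_hom_ext {f g : RatExt G L →ₗ[MonoidAlgebra ℚ G] V}
    (h : ∀ x : L, f (ratMk G x) = g (ratMk G x)) : f = g := by
  refine LinearMap.ext fun v => ?_
  obtain ⟨n, hn, x, hx⟩ := exists_zsmul_eq_ratMk v
  refine zsmul_injective_of_rat G hn ?_
  rw [← map_zsmul, ← map_zsmul, hx, h]

/-- An injective map with torsion cokernel becomes an isomorphism over `ℚ`. -/
noncomputable def ratMapEquiv (f : L →ₗ[MonoidAlgebra ℤ G] M) (hf : Function.Injective f)
    (hr : ∀ y : M, ∃ n : ℤ, n ≠ 0 ∧ ∃ x, f x = n • y) :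
    RatExt G L ≃ₗ[MonoidAlgebra ℚ G] RatExt G M :=
  LinearEquiv.ofBijective (ratMap f) ⟨(injective_iff_map_eq_zero _).2 fun v hv => by
    obtain ⟨n, hn, x, hx⟩ := exists_zsmul_eq_ratMk v
    have h1 : ratMk G (f x) = 0 := by
      rw [← ratMap_ratMk, ← hx, map_zsmul, hv, smul_zero]
    obtain ⟨k, hk, hkx⟩ := ratMk_eq_zero_iff.1 h1
    have h2 : ratMk G x = 0 := ratMk_eq_zero_iff.2 ⟨k, hk, hf (by rw [map_zsmul, hkx, map_zero])⟩
    exact zsmul_injective_of_rat G hn (by rw [hx, h2, smul_zero]), fun v => by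
    obtain ⟨n, hn, y, hy⟩ := exists_zsmul_eq_ratMk v
    obtain ⟨k, hk, x, hx⟩ := hr y
    obtain ⟨w, hw⟩ := exists_zsmul_eq G (mul_ne_zero hk hn) (ratMk G x)
    refine ⟨w, zsmul_injective_of_rat G (mul_ne_zero hk hn) ?_⟩
    rw [← map_zsmul, hw, ratMap_ratMk, hx, map_zsmul, ← hy, mul_smul]⟩

/-- The restriction to a submodule of finite index of an isomorphism `ℚ ⊗ M ≅ V`. -/
noncomputable def ratRestrict (L : Submodule (MonoidAlgebra ℤ G) M)
    (hL : L.toAddSubgroup.FiniteIndex) (e : RatExt G M ≃ₗ[MonoidAlgebra ℚ G] V) :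
    RatExt G L ≃ₗ[MonoidAlgebra ℚ G] V :=
  (ratMapEquiv L.subtype Subtype.val_injective fun y =>
    ⟨L.toAddSubgroup.index, Nat.cast_ne_zero.2 hL.index_ne_zero,
      ⟨_, L.toAddSubgroup.nsmul_index_mem y⟩, (natCast_zsmul y _).symm⟩).trans e

theorem ratRestrict_ratMk (L : Submodule (MonoidAlgebra ℤ G) M)
    (hL : L.toAddSubgroup.FiniteIndex) (e : RatExt G M ≃ₗ[MonoidAlgebra ℚ G] V) (x : L) :
    ratRestrict L hL e (ratMk G x) = e (ratMk G (x : M)) := rfl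

/-- The action of `Aut L` on `V` through an isomorphism `e : ℚ ⊗ L ≅ V`. -/
noncomputable def autRat (e : RatExt G L ≃ₗ[MonoidAlgebra ℚ G] V) :
    (L ≃ₗ[MonoidAlgebra ℤ G] L) →* (V ≃ₗ[MonoidAlgebra ℚ G] V) where
  toFun σ := e.symm.trans ((ratMapEquiv (σ : L →ₗ[MonoidAlgebra ℤ G] L) σ.injective fun y =>
    ⟨1, one_ne_zero, σ.symm y, by simp⟩).trans e)
  map_one' := LinearEquiv.ext fun v => by
    have h : ratMap ((1 : L ≃ₗ[MonoidAlgebra ℤ G] L) : L →ₗ[MonoidAlgebra ℤ G] L) =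
      LinearMap.id := ratExt_hom_ext fun x => rfl
    change e (ratMap _ (e.symm v)) = v
    rw [h, LinearMap.id_apply, e.apply_symm_apply]
  map_mul' σ τ := LinearEquiv.ext fun v => by
    have h : ratMap ((σ * τ : L ≃ₗ[MonoidAlgebra ℤ G] L) : L →ₗ[MonoidAlgebra ℤ G] L) =
        (ratMap (σ : L →ₗ[MonoidAlgebra ℤ G] L)).comp
          (ratMap (τ : L →ₗ[MonoidAlgebra ℤ G] L)) := ratExt_hom_ext fun x => rfl
    change e (ratMap _ (e.symm v)) = e (ratMap _ (e.symm (e (ratMap _ (e.symm v)))))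
    rw [h, e.symm_apply_apply, LinearMap.comp_apply]

theorem autRat_ratMk (e : RatExt G L ≃ₗ[MonoidAlgebra ℚ G] V) (σ : L ≃ₗ[MonoidAlgebra ℤ G] L)
    (x : L) : autRat e σ (e (ratMk G x)) = e (ratMk G (σ x)) := by
  change e (ratMap (σ : L →ₗ[MonoidAlgebra ℤ G] L) (e.symm (e (ratMk G x)))) = _
  rw [e.symm_apply_apply, ratMap_ratMk]
  rfl

theorem linearEquiv_ext_ratMk (e : RatExt G L ≃ₗ[MonoidAlgebra ℚ G] V)
    {g h : V ≃ₗ[MonoidAlgebra ℚ G] V} (H : ∀ x, g (e (ratMk G x)) = h (e (ratMk G x))) : g = h := by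
  have h1 : (g : V →ₗ[MonoidAlgebra ℚ G] V).comp (e : RatExt G L →ₗ[MonoidAlgebra ℚ G] V) =
      (h : V →ₗ[MonoidAlgebra ℚ G] V).comp (e : RatExt G L →ₗ[MonoidAlgebra ℚ G] V) :=
    ratExt_hom_ext H
  refine LinearEquiv.ext fun v => ?_
  rw [← e.apply_symm_apply v]
  exact LinearMap.congr_fun h1 (e.symm v)

/-- Automorphisms of `L` and `M` that correspond under a map that induces multiplication by `k ≠ 0`
on `V` have the same action on `V`. -/
theorem autRat_eq_autRat {eL : RatExt G L ≃ₗ[MonoidAlgebra ℚ G] V}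
    {eM : RatExt G M ≃ₗ[MonoidAlgebra ℚ G] V} (f : L → M) {k : ℤ} (hk : k ≠ 0)
    (hf : ∀ x, eM (ratMk G (f x)) = k • eL (ratMk G x)) {σ : M ≃ₗ[MonoidAlgebra ℤ G] M}
    {τ : L ≃ₗ[MonoidAlgebra ℤ G] L} (h : ∀ x, f (τ x) = σ (f x)) :
    autRat eL τ = autRat eM σ := by
  refine linearEquiv_ext_ratMk eL fun x => zsmul_injective_of_rat G hk ?_
  rw [autRat_ratMk, ← hf, h, ← autRat_ratMk, hf, map_zsmul]

theorem autRat_trans (e : RatExt G L ≃ₗ[MonoidAlgebra ℚ G] V) (g : V ≃ₗ[MonoidAlgebra ℚ G] V)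
    (σ : L ≃ₗ[MonoidAlgebra ℤ G] L) : autRat (e.trans g) σ = MulAut.conj g (autRat e σ) := by
  refine linearEquiv_ext_ratMk (e.trans g) fun x => ?_
  rw [autRat_ratMk, MulAut.conj_apply, LinearEquiv.mul_apply, LinearEquiv.mul_apply]
  change g (e (ratMk G (σ x))) = g (autRat e σ (g.symm (g (e (ratMk G x)))))
  rw [g.symm_apply_apply, autRat_ratMk]

theorem finite_ker_autRat [Module.Finite ℤ L] (e : RatExt G L ≃ₗ[MonoidAlgebra ℚ G] V) :
    Finite (autRat e).ker :=
  finite_of_forall_sub_torsion _ fun σ hσ x => by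
    refine (ratMk_eq_zero_iff (G := G)).1 (e.injective ?_)
    rw [map_sub, map_sub, map_zero, ← autRat_ratMk, MonoidHom.mem_ker.1 hσ]
    exact sub_self _

theorem autRat_autRestrict (L : Submodule (MonoidAlgebra ℤ G) M)
    (hL : L.toAddSubgroup.FiniteIndex) (e : RatExt G M ≃ₗ[MonoidAlgebra ℚ G] V)
    (σ : autStabilizer L) : autRat (ratRestrict L hL e) (autRestrict L σ) = autRat e σ.1 :=
  autRat_eq_autRat (k := 1) (Subtype.val : L → M) one_ne_zero
    (fun x => by rw [ratRestrict_ratMk, one_smul]) fun x => rfl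

theorem exists_common_denominator [Module.Finite ℤ L] (eL : RatExt G L ≃ₗ[MonoidAlgebra ℚ G] V)
    (eM : RatExt G M ≃ₗ[MonoidAlgebra ℚ G] V) :
    ∃ k : ℤ, k ≠ 0 ∧ ∀ x : L, ∃ y : M, eM (ratMk G y) = k • eL (ratMk G x) := by
  suffices h : ∀ N : Submodule ℤ L, N.FG → ∃ k : ℤ, k ≠ 0 ∧ ∀ x ∈ N, ∃ y : M,
      eM (ratMk G y) = k • eL (ratMk G x) by
    obtain ⟨k, hk, h⟩ := h ⊤ Module.Finite.fg_top
    exact ⟨k, hk, fun x => h x Submodule.mem_top⟩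
  intro N hN
  induction N, hN using Submodule.fg_induction with
  | singleton x =>
    obtain ⟨k, hk, y, hy⟩ := exists_zsmul_eq_ratMk (eM.symm (eL (ratMk G x)))
    refine ⟨k, hk, fun z hz => ?_⟩
    obtain ⟨a, rfl⟩ := Submodule.mem_span_singleton.1 hz
    refine ⟨a • y, ?_⟩
    rw [map_zsmul, map_zsmul, ← hy, map_zsmul, eM.apply_symm_apply, map_zsmul, map_zsmul,
      smul_comm]
  | sup N₁ N₂ _ _ h1 h2 =>
    obtain ⟨k₁, hk₁, h1⟩ := h1
    obtain ⟨k₂, hk₂, h2⟩ := h2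
    refine ⟨k₁ * k₂, mul_ne_zero hk₁ hk₂, fun x hx => ?_⟩
    obtain ⟨x₁, hx₁, x₂, hx₂, rfl⟩ := Submodule.mem_sup.1 hx
    obtain ⟨y₁, hy₁⟩ := h1 x₁ hx₁
    obtain ⟨y₂, hy₂⟩ := h2 x₂ hx₂
    refine ⟨k₂ • y₁ + k₁ • y₂, ?_⟩
    simp only [map_add, map_zsmul, hy₁, hy₂, smul_add, smul_smul, mul_comm k₁ k₂]

/-- Two finitely generated `ℤ[G]`-modules with the same rational extension are commensurable: some
`X` of finite index in `L` embeds into `M` with finite index, the embedding inducing multiplication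
by a nonzero integer on `V`. -/
theorem exists_common_submodule [Module.Finite ℤ L] [Module.Finite ℤ M]
    (eL : RatExt G L ≃ₗ[MonoidAlgebra ℚ G] V) (eM : RatExt G M ≃ₗ[MonoidAlgebra ℚ G] V) :
    ∃ X : Submodule (MonoidAlgebra ℤ G) L, X.toAddSubgroup.FiniteIndex ∧
      ∃ j : X →ₗ[MonoidAlgebra ℤ G] M, Function.Injective j ∧
        (LinearMap.range j).toAddSubgroup.FiniteIndex ∧
        ∃ k : ℤ, k ≠ 0 ∧ ∀ x : X, eM (ratMk G (j x)) = k • eL (ratMk G (x : L)) := by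
  obtain ⟨k, hk, hy⟩ := exists_common_denominator eL eM
  obtain ⟨-, m, hm0, hm⟩ := exists_nsmul_torsion_eq_zero M
  obtain ⟨-, l, hl0, hl⟩ := exists_nsmul_torsion_eq_zero L
  choose y hy using hy
  -- `y x` is determined up to torsion, so that `m • y x` is well defined
  have huniq : ∀ a b : M, eM (ratMk G a) = eM (ratMk G b) → m • a = m • b := fun a b h => by
    have h1 : m • (a - b) = 0 := hm _ ((ratMk_eq_zero_iff (G := G)).1 (by
      rw [map_sub, eM.injective h, sub_self]))
    rwa [smul_sub, sub_eq_zero] at h1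
  let j₀ : L →ₗ[MonoidAlgebra ℤ G] M :=
    { toFun := fun x => m • y x
      map_add' := fun a b => by
        rw [← smul_add]
        refine huniq _ _ ?_
        simp only [hy, map_add, smul_add]
      map_smul' := fun r a => by
        rw [RingHom.id_apply, smul_comm r m]
        refine huniq _ _ ?_
        rw [hy, ratMk_smul, ratMk_smul, map_smul, map_smul, hy, smul_comm] }
  have hj₀ : ∀ x, eM (ratMk G (j₀ x)) = (m * k : ℤ) • eL (ratMk G x) := fun x => by
    change eM (ratMk G (m • y x)) = _
    rw [map_nsmul, map_nsmul, hy, mul_smul, natCast_zsmul]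
  have hmk : (m * k : ℤ) ≠ 0 := mul_ne_zero (Nat.cast_ne_zero.2 hm0) hk
  have hl0' : (l : ℤ) ≠ 0 := Nat.cast_ne_zero.2 hl0
  have hX : ∀ x : L, (l : ℤ) • x ∈ nsmulSubmodule (MonoidAlgebra ℤ G) L l := fun x =>
    mem_nsmulSubmodule.2 ⟨x, (natCast_zsmul x l).symm⟩
  refine ⟨nsmulSubmodule _ L l, finiteIndex_of_forall_zsmul_mem _ fun x => ⟨l, hl0', hX x⟩,
    j₀.comp (Submodule.subtype _), (injective_iff_map_eq_zero _).2 ?_,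
    finiteIndex_of_forall_zsmul_mem _ fun z => ?_, m * k, hmk, fun x => hj₀ x⟩
  · rintro ⟨x, hx⟩ h
    obtain ⟨w, rfl⟩ := mem_nsmulSubmodule.1 hx
    have h1 : eL (ratMk G (l • w)) = 0 := zsmul_injective_of_rat G hmk (by
      rw [← hj₀, smul_zero]
      exact (congrArg (fun t => eM (ratMk G t)) h).trans (by simp))
    obtain ⟨n, hn, hnw⟩ := ratMk_eq_zero_iff.1 (eL.map_eq_zero_iff.1 h1)
    refine Subtype.ext (hl w ⟨n * l, mul_ne_zero hn hl0', ?_⟩)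
    rw [mul_smul, natCast_zsmul, hnw]
  · obtain ⟨n, hn, x, hx⟩ := exists_zsmul_eq_ratMk (eL.symm (eM (ratMk G z)))
    have h1 : eL (ratMk G x) = n • eM (ratMk G z) := by
      rw [← hx, map_zsmul, eL.apply_symm_apply]
    have h2 : eM (ratMk G (j₀ ((l : ℤ) • x) - (m * k * l * n : ℤ) • z)) = 0 := by
      rw [map_sub, map_sub, hj₀, map_zsmul, map_zsmul, h1, map_zsmul, map_zsmul, smul_smul,
        smul_smul, sub_self]
    obtain ⟨n', hn', h3⟩ := ratMk_eq_zero_iff.1 (eM.map_eq_zero_iff.1 h2)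
    refine ⟨n' * (m * k * l * n), mul_ne_zero hn' (mul_ne_zero (mul_ne_zero hmk hl0') hn),
      ⟨n' • (l : ℤ) • x, Submodule.smul_of_tower_mem _ n' (hX x)⟩, ?_⟩
    change j₀ (n' • (l : ℤ) • x) = _
    rw [mul_smul, map_zsmul, ← sub_eq_zero, ← smul_sub, h3]

end RatExt

/-! ### Orders of automorphism groups relative to a common overgroup -/

section Comparison

open Subgroup

variable {G : Type*} [Group G]
variable {L : Type*} [AddCommGroup L] [Module (MonoidAlgebra ℤ G) L]
variable {M : Type*} [AddCommGroup M] [Module (MonoidAlgebra ℤ G) M]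
variable {V : Type*} [AddCommGroup V] [Module (MonoidAlgebra ℚ G) V]

theorem commensurable_range_ratRestrict [Module.Finite ℤ M] (L : Submodule (MonoidAlgebra ℤ G) M)
    (hL : L.toAddSubgroup.FiniteIndex) (e : RatExt G M ≃ₗ[MonoidAlgebra ℚ G] V) :
    Commensurable (autRat e).range (autRat (ratRestrict L hL e)).range :=
  have := finiteIndex_autStabilizer L hL
  have := finiteIndex_range_autRestrict L hL
  commensurable_range (autStabilizer L) (autRestrict L) _ _ (autRat_autRestrict L hL e)

/-- Conjugation by an isomorphism, as an isomorphism of automorphism groups. -/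
def LinearEquiv.autConj {R : Type*} [Ring R] {L M : Type*} [AddCommGroup L] [AddCommGroup M]
    [Module R L] [Module R M] (u : L ≃ₗ[R] M) : (L ≃ₗ[R] L) ≃* (M ≃ₗ[R] M) where
  toFun τ := u.symm.trans (τ.trans u)
  invFun σ := u.trans (σ.trans u.symm)
  left_inv τ := by ext; simp
  right_inv σ := by ext; simp
  map_mul' τ τ' := by ext; simp

theorem autRat_autConj {eL : RatExt G L ≃ₗ[MonoidAlgebra ℚ G] V}
    {eM : RatExt G M ≃ₗ[MonoidAlgebra ℚ G] V} (u : L ≃ₗ[MonoidAlgebra ℤ G] M) {k : ℤ}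
    (hk : k ≠ 0) (hu : ∀ x, eM (ratMk G (u x)) = k • eL (ratMk G x)) :
    autRat eL = (autRat eM).comp u.autConj.toMonoidHom :=
  MonoidHom.ext fun τ => autRat_eq_autRat u hk hu fun x =>
    congrArg (fun y => u (τ y)) (u.symm_apply_apply x).symm

theorem range_comp_mulEquiv {X Y Z : Type*} [Group X] [Group Y] [Group Z] (c : X ≃* Y)
    (ψ : Y →* Z) : (ψ.comp c.toMonoidHom).range = ψ.range := by
  ext z
  exact ⟨fun ⟨x, hx⟩ => ⟨c x, hx⟩, fun ⟨y, hy⟩ => ⟨c.symm y, by simpa using hy⟩⟩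

theorem card_ker_comp_mulEquiv {X Y Z : Type*} [Group X] [Group Y] [Group Z] (c : X ≃* Y)
    (ψ : Y →* Z) : Nat.card (ψ.comp c.toMonoidHom).ker = Nat.card ψ.ker :=
  Nat.card_congr (c.toEquiv.subtypeEquiv fun _ => Iff.rfl)

/-- All images of automorphism groups in `Aut V` are commensurable. -/
theorem commensurable_range_autRat [Module.Finite ℤ L] [Module.Finite ℤ M]
    (eL : RatExt G L ≃ₗ[MonoidAlgebra ℚ G] V) (eM : RatExt G M ≃ₗ[MonoidAlgebra ℚ G] V) :
    Commensurable (autRat eL).range (autRat eM).range := by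
  obtain ⟨X, hX, j, hj, hY, k, hk, h⟩ := exists_common_submodule eL eM
  have h1 := commensurable_range_ratRestrict X hX eL
  have h2 := commensurable_range_ratRestrict (LinearMap.range j) hY eM
  rw [autRat_autConj (eL := ratRestrict X hX eL) (eM := ratRestrict (LinearMap.range j) hY eM)
    (LinearEquiv.ofInjective j hj) hk h, range_comp_mulEquiv] at h1
  exact h1.trans h2.symm

theorem range_autRat_trans (e : RatExt G L ≃ₗ[MonoidAlgebra ℚ G] V)
    (g : V ≃ₗ[MonoidAlgebra ℚ G] V) :
    (autRat (e.trans g)).range = (autRat e).range.map (MulAut.conj g).toMonoidHom := by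
  rw [MonoidHom.map_range]
  exact congrArg MonoidHom.range (MonoidHom.ext fun σ => autRat_trans e g σ)

theorem card_ker_autRat_trans (e : RatExt G L ≃ₗ[MonoidAlgebra ℚ G] V)
    (g : V ≃ₗ[MonoidAlgebra ℚ G] V) :
    Nat.card (autRat (e.trans g)).ker = Nat.card (autRat e).ker := by
  congr 2
  ext σ
  rw [MonoidHom.mem_ker, MonoidHom.mem_ker, autRat_trans, map_eq_one_iff _ (MulEquiv.injective _)]

theorem isMulTorsionFree_posRat : IsMulTorsionFree {q : ℚ // 0 < q} where
  pow_left_injective _ hn a b h := Subtype.ext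
    ((pow_left_inj₀ a.2.le b.2.le hn).1 (congrArg Subtype.val h))

/-- The modular function of the image of `Aut L` in `Aut V` is trivial, being a homomorphism from
`Aut V` to the positive rationals that is trivial on the centre. -/
theorem genIndex_conj_eq_one [Finite G] [Module.Finite (MonoidAlgebra ℚ G) V] [Module.Finite ℤ L]
    (e : RatExt G L ≃ₗ[MonoidAlgebra ℚ G] V) (g : V ≃ₗ[MonoidAlgebra ℚ G] V) :
    genIndex ((autRat e).range.map (MulAut.conj g).toMonoidHom) (autRat e).range = 1 := by
  let _ : Module ℚ V := Module.compHom V (algebraMap ℚ (MonoidAlgebra ℚ G))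
  have : IsScalarTower ℚ (MonoidAlgebra ℚ G) V := ⟨fun q a v => by
    rw [Algebra.smul_def, mul_smul]
    rfl⟩
  have : Module.Finite ℚ (MonoidAlgebra ℚ G) :=
    Module.Finite.equiv (MonoidAlgebra.coeffLinearEquiv ℚ).symm
  have : Module.Finite ℚ V := Module.Finite.trans (MonoidAlgebra ℚ G) V
  have : NeZero (Nat.card G : ℚ) := ⟨Nat.cast_ne_zero.2 Nat.card_pos.ne'⟩
  have := isMulTorsionFree_posRat
  have hΓ : ∀ g : V ≃ₗ[MonoidAlgebra ℚ G] V,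
      Commensurable ((autRat e).range.map (MulAut.conj g).toMonoidHom) (autRat e).range :=
    fun g => range_autRat_trans e g ▸ commensurable_range_autRat (e.trans g) e
  have h := CentralHomTrivial.linearEquiv ℚ (R := MonoidAlgebra ℚ G) (V := V)
    (modularHom (autRat e).range hΓ) (fun z hz => Subtype.ext ?_) g
  · exact congrArg Subtype.val h
  · have h1 : (MulAut.conj z).toMonoidHom = MonoidHom.id (V ≃ₗ[MonoidAlgebra ℚ G] V) :=
      MonoidHom.ext fun x => by
        change z * x * z⁻¹ = x
        rw [← mem_center_iff.1 hz x, mul_inv_cancel_right]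
    change genIndex ((autRat e).range.map (MulAut.conj z).toMonoidHom) (autRat e).range = 1
    rw [h1, map_id, genIndex_self]

/-- The order of `Aut L` relative to a subgroup `Γ` of `Aut V` commensurable with its image: the
order of the finite kernel of `Aut L → Aut V`, times the generalised index of the image over `Γ`. -/
noncomputable def relOrder (Γ : Subgroup (V ≃ₗ[MonoidAlgebra ℚ G] V))
    (e : RatExt G L ≃ₗ[MonoidAlgebra ℚ G] V) : ℚ :=
  Nat.card (autRat e).ker * genIndex (autRat e).range Γ

variable {Γ : Subgroup (V ≃ₗ[MonoidAlgebra ℚ G] V)}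

theorem relOrder_pos [Module.Finite ℤ L] (e : RatExt G L ≃ₗ[MonoidAlgebra ℚ G] V)
    (hΓ : Commensurable (autRat e).range Γ) : 0 < relOrder Γ e :=
  have := finite_ker_autRat e
  mul_pos (Nat.cast_pos.2 Nat.card_pos) (genIndex_pos hΓ)

/-- The relative order does not depend on the chosen isomorphism `ℚ ⊗ L ≅ V`, nor on the choice
of `L` up to isomorphism. -/
theorem relOrder_eq [Finite G] [Module.Finite (MonoidAlgebra ℚ G) V] [Module.Finite ℤ L]
    [Module.Finite ℤ M] (eL : RatExt G L ≃ₗ[MonoidAlgebra ℚ G] V)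
    (eM : RatExt G M ≃ₗ[MonoidAlgebra ℚ G] V) (u : L ≃ₗ[MonoidAlgebra ℤ G] M)
    (hΓ : Commensurable (autRat eM).range Γ) : relOrder Γ eL = relOrder Γ eM := by
  -- transport `eM` along `u`; then only the choice of isomorphism for `L` differs
  let e := (ratMapEquiv (u : L →ₗ[MonoidAlgebra ℤ G] M) u.injective fun y =>
    ⟨1, one_ne_zero, u.symm y, by simp⟩).trans eM
  have h1 : autRat e = (autRat eM).comp u.autConj.toMonoidHom :=
    autRat_autConj u one_ne_zero fun x => (one_smul ℤ _).symm
  have h2 : relOrder Γ e = relOrder Γ eM := by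
    rw [relOrder, relOrder, h1, range_comp_mulEquiv, card_ker_comp_mulEquiv]
  have hΓ' : Commensurable (autRat e).range Γ := by rwa [h1, range_comp_mulEquiv]
  have h3 : eL = e.trans (e.symm.trans eL) := by ext; simp
  rw [← h2, relOrder, relOrder, h3, card_ker_autRat_trans, range_autRat_trans,
    ← genIndex_mul_genIndex (range_autRat_trans e _ ▸ commensurable_range_autRat _ e) hΓ',
    genIndex_conj_eq_one, one_mul]

theorem relOrder_div_relOrder [Finite G] [Module.Finite (MonoidAlgebra ℚ G) V] [Module.Finite ℤ M]
    (L : Submodule (MonoidAlgebra ℤ G) M) (hL : L.toAddSubgroup.FiniteIndex) [Module.Finite ℤ L]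
    (eL : RatExt G L ≃ₗ[MonoidAlgebra ℚ G] V) (eM : RatExt G M ≃ₗ[MonoidAlgebra ℚ G] V)
    (hΓ : Commensurable (autRat eM).range Γ) :
    relOrder Γ eM / relOrder Γ eL =
      ((autStabilizer L).index : ℚ) * (Nat.card (autRestrict L).ker : ℚ) /
        ((autRestrict L).range.index : ℚ) := by
  have := finiteIndex_autStabilizer L hL
  have := finiteIndex_range_autRestrict L hL
  have := finite_ker_autRat eM
  have := finite_ker_autRat (ratRestrict L hL eM)
  have hc := commensurable_range_ratRestrict L hL eM
  have hΓ' := hc.symm.trans hΓ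
  rw [relOrder_eq eL (ratRestrict L hL eM) (LinearEquiv.refl _ _) hΓ',
    div_eq_iff (relOrder_pos _ hΓ').ne', relOrder, relOrder, ← genIndex_mul_genIndex hc hΓ',
    ← mul_assoc, ← mul_assoc,
    card_ker_mul_genIndex_range (autStabilizer L) (autRestrict L) _ _ (autRat_autRestrict L hL eM)]

end Comparison

theorem module_finite_int_of_mem_integralForms {G : Type u} [Group G] [Finite G] {V : Type v}
    [AddCommGroup V] [Module (MonoidAlgebra ℚ G) V] (M : integralForms.{u, v, w} G V) :
    Module.Finite ℤ M.1 :=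
  have : Module.Finite ℤ (MonoidAlgebra ℤ G) :=
    Module.Finite.equiv (MonoidAlgebra.coeffLinearEquiv ℤ).symm
  have := M.2.1
  Module.Finite.trans (MonoidAlgebra ℤ G) M.1

/-- The three properties that characterise the index of automorphism groups: invariance under
isomorphism, multiplicativity, and the value at a submodule of finite index. -/
def IsAutIndex {G : Type u} [Group G] [Finite G] {V : Type v} [AddCommGroup V]
    [Module (MonoidAlgebra ℚ G) V]
    (ia : integralForms.{u, v, w} G V → integralForms.{u, v, w} G V → {q : ℚ // 0 < q}) : Prop :=
  (∀ L L' M M' : integralForms.{u, v, w} G V,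
    Nonempty (L.1 ≃ₗ[MonoidAlgebra ℤ G] L'.1) → Nonempty (M.1 ≃ₗ[MonoidAlgebra ℤ G] M'.1) →
      ia L M = ia L' M') ∧
  (∀ L M N : integralForms.{u, v, w} G V, ia L M * ia M N = ia L N) ∧
  (∀ (M : integralForms.{u, v, w} G V) (L : Submodule (MonoidAlgebra ℤ G) M.1)
    (hL : L.toAddSubgroup.FiniteIndex),
    (ia ⟨ModuleCat.of (MonoidAlgebra ℤ G) L, integralForms_submodule M L hL⟩ M : ℚ) =
      ((autStabilizer L).index : ℚ) * (Nat.card (autRestrict L).ker : ℚ) /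
        ((autRestrict L).range.index : ℚ))

/-- Any two integral forms of `V` have isomorphic submodules of finite index, which determines
`ia`. -/
theorem IsAutIndex.unique {G : Type u} [Group G] [Finite G] {V : Type v} [AddCommGroup V]
    [Module (MonoidAlgebra ℚ G) V]
    {f f' : integralForms.{u, v, w} G V → integralForms.{u, v, w} G V → {q : ℚ // 0 < q}}
    (hf : IsAutIndex f) (hf' : IsAutIndex f') : f = f' := by
  obtain ⟨a, b, hc⟩ := hf
  obtain ⟨a', b', hc'⟩ := hf'
  funext L M
  have := module_finite_int_of_mem_integralForms L
  have := module_finite_int_of_mem_integralForms M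
  obtain ⟨X, hX, j, hj, hY, -⟩ := exists_common_submodule L.2.2.some M.2.2.some
  let X' : integralForms.{u, v, w} G V := ⟨ModuleCat.of _ X, integralForms_submodule L X hX⟩
  let Y' : integralForms.{u, v, w} G V :=
    ⟨ModuleCat.of _ (LinearMap.range j), integralForms_submodule M _ hY⟩
  have hXY : Nonempty (X'.1 ≃ₗ[MonoidAlgebra ℤ G] Y'.1) := ⟨LinearEquiv.ofInjective j hj⟩
  have hM : Nonempty (M.1 ≃ₗ[MonoidAlgebra ℤ G] M.1) := ⟨LinearEquiv.refl _ _⟩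
  have h1 : f X' L = f' X' L := Subtype.ext ((hc L X hX).trans (hc' L X hX).symm)
  have h2 : f X' M = f' X' M := by
    rw [a _ _ _ _ hXY hM, a' _ _ _ _ hXY hM]
    exact Subtype.ext ((hc M _ hY).trans (hc' M _ hY).symm)
  refine mul_left_cancel (a := f X' L) ?_
  rw [b, h1, b', h2]

/-- The quotient of the orders of `Aut M` and `Aut L`, both taken relative to the image in `Aut V`
of one fixed automorphism group, is an index function. -/
theorem exists_isAutIndex (G : Type u) [Group G] [Finite G] (V : Type v) [AddCommGroup V]
    [Module (MonoidAlgebra ℚ G) V] [Module.Finite (MonoidAlgebra ℚ G) V] :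
    ∃ ia : integralForms.{u, v, w} G V → integralForms.{u, v, w} G V → {q : ℚ // 0 < q},
      IsAutIndex ia := by
  have hfin := module_finite_int_of_mem_integralForms (G := G) (V := V)
  rcases isEmpty_or_nonempty (integralForms.{u, v, w} G V) with hS | ⟨⟨L₀⟩⟩
  · exact ⟨fun L => isEmptyElim L, fun L => isEmptyElim L, fun L => isEmptyElim L,
      fun L => isEmptyElim L⟩
  -- relative orders are taken with respect to the image of `Aut L₀`, for a fixed form `L₀`
  let e : ∀ M : integralForms.{u, v, w} G V, RatExt G M.1 ≃ₗ[MonoidAlgebra ℚ G] V :=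
    fun M => M.2.2.some
  let Γ := (autRat (e L₀)).range
  have hΓ : ∀ M, Subgroup.Commensurable (autRat (e M)).range Γ := fun M =>
    commensurable_range_autRat _ _
  have hpos : ∀ M, 0 < relOrder Γ (e M) := fun M => relOrder_pos _ (hΓ M)
  refine ⟨fun L M => ⟨relOrder Γ (e M) / relOrder Γ (e L), div_pos (hpos M) (hpos L)⟩,
    fun L L' M M' ⟨u⟩ ⟨u'⟩ => ?_, fun L M N => Subtype.ext ?_, fun M L hL => ?_⟩
  · simp only [relOrder_eq (e L) (e L') u (hΓ L'), relOrder_eq (e M) (e M') u' (hΓ M')]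
  · change relOrder Γ (e M) / relOrder Γ (e L) * (relOrder Γ (e N) / relOrder Γ (e M)) =
      relOrder Γ (e N) / relOrder Γ (e L)
    rw [mul_comm, div_mul_div_cancel₀ (hpos M).ne']
  · have : Module.Finite ℤ L := hfin ⟨ModuleCat.of _ L, integralForms_submodule M L hL⟩
    exact relOrder_div_relOrder L hL _ (e M) (hΓ M)

theorem theorem1p1 (G : Type u) [Group G] [Finite G] (V : Type v) [AddCommGroup V]
    [Module (MonoidAlgebra ℚ G) V] [Module.Finite (MonoidAlgebra ℚ G) V] :
    (∀ (M : integralForms.{u, v, w} G V) (L : Submodule (MonoidAlgebra ℤ G) M.1),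
      L.toAddSubgroup.FiniteIndex →
        (autStabilizer L).FiniteIndex ∧ Finite (autRestrict L).ker ∧
          (autRestrict L).range.FiniteIndex) ∧
    ∃! ia : integralForms.{u, v, w} G V → integralForms.{u, v, w} G V → {q : ℚ // 0 < q},
      (∀ L L' M M' : integralForms.{u, v, w} G V,
        Nonempty (L.1 ≃ₗ[MonoidAlgebra ℤ G] L'.1) → Nonempty (M.1 ≃ₗ[MonoidAlgebra ℤ G] M'.1) →
          ia L M = ia L' M') ∧
      (∀ L M N : integralForms.{u, v, w} G V, ia L M * ia M N = ia L N) ∧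
      (∀ (M : integralForms.{u, v, w} G V) (L : Submodule (MonoidAlgebra ℤ G) M.1)
        (hL : L.toAddSubgroup.FiniteIndex),
        (ia ⟨ModuleCat.of (MonoidAlgebra ℤ G) L, integralForms_submodule M L hL⟩ M : ℚ) =
          ((autStabilizer L).index : ℚ) * (Nat.card (autRestrict L).ker : ℚ) /
            ((autRestrict L).range.index : ℚ)) := by
  have hfin := module_finite_int_of_mem_integralForms (G := G) (V := V)
  exact ⟨fun M L hL => ⟨finiteIndex_autStabilizer L hL, finite_ker_autRestrict L hL,
    finiteIndex_range_autRestrict L hL⟩,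
    existsUnique_of_exists_of_unique (exists_isAutIndex G V) fun _ _ => IsAutIndex.unique⟩
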